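/- **Setting.** Let $\mathbb{P}_d$ be the set of real polynomials of degree at most $d$, and $\|\cdot\|_{\mathsf F}$ the Frobenius norm. Let $1\le k\le n$, $s\ge 1$ and $r\ge 0$ be integers, let $\delta\in(0,1)$, and let $f:\mathbb{R}\to\mathbb{R}$ be any function. Let $A=U\Lambda U^{\mathsf T}\in\mathbb{R}^{n\times n}$ be symmetric, with $U$ orthogonal and $\Lambda=\operatorname{diag}(\lambda_1,\dots,\lambda_n)$, the eigenvalues being ordered so that $|f(\lambda_1)|\ge|f(\lambda_2)|\ge\dots\ge|f(\lambda_n)|$. Put $\Lambda_{n\setminus k}=\operatorname{diag}(\lambda_{k+1},\dots,\lambda_n)$, and let $\lambda_{\min}$, $\lambda_{\max}$ be the smallest and largest eigenvalue of $A$. **Algorithm.** Let $\omega\in\mathbb{R}^n$ be a standard Gaussian vector. Run $q=k+s+r$ iterations of the Lanczos algorithm (in exact arithmetic, with reorthogonalization, with blocks of width zero once the Krylov spaces are exhausted) on $A$ with starting vector $\omega$. This gives a matrix $Q_q$ with orthonormal columns and a tridiagonal matrix $T_q$. Let $Q_{k+s}$ consist of the columns of $Q_q$ produced by the first $k+s$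 blocks; they form an orthonormal basis of $\operatorname{span}\{\omega,A\omega,\dots,A^{k+s-1}\omega\}$. Let $d$ be the dimension of this space, and let $X=f(T_q)_{1:d,1:d}$ be the leading $d\times d$ block of the matrix function $f(T_q)$. The output is $$\widehat{\mathsf{ALG}}_k(s,r;f)=Q_{k+s}\,[\![X]\!]_k\,Q_{k+s}^{\mathsf T},$$ where $[\![X]\!]_k$ is the rank-$k$ truncation of a singular value decomposition of $X$. **Theorem 4.1.** Define $$\gamma_{\min}=\min_{\substack{i,j=1,\dots,k\\ i\ne j}}\frac{|\lambda_j-\lambda_i|}{|\lambda_{\max}-\lambda_{\min}|},\qquad \widehat C_\delta=\frac{2\pi\,(1+6\log(2/\delta))}{\delta^2},$$ $$\mathcal E(s;f)=\inf_{p}\ \Big[\|p(\Lambda_{n\setminus k})\|_{\mathsf F}^2\ \max_{i=1,\dots,k}\Big|\frac{f(\lambda_i)}{p(\lambda_i)}\Big|^2\Big],$$ the infimum being over all $p\in\mathbb{P}_{s-1}$ with $p(\lambda_i)\neq0$ for $i=1,\dots,k$. If $k\ge2$, assume that $\lambda_1,\dots,\lambda_k$ are pairwise distinct, i.e. $\gamma_{\min}\ne0$;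 if $k=1$, the factor $\gamma_{\min}^{2(k-1)}$ is read as $1$. Then, with probability at least $1-\delta$ over $\omega$, $$\|f(A)-\widehat{\mathsf{ALG}}_k(s,r;f)\|_{\mathsf F}\ \le\ 4\sqrt{k+s}\,\inf_{p\in\mathbb{P}_{2r+1}}\ \sup_{x\in[\lambda_{\min},\lambda_{\max}]}|f(x)-p(x)|\ +\ \sqrt{\|f(\Lambda_{n\setminus k})\|_{\mathsf F}^2+\widehat C_\delta\,\frac{k^4}{\gamma_{\min}^{2(k-1)}}\,\mathcal E(s;f)}\,.$$ More precisely, there is an event of probability at least $1-\delta$ on which the inequality holds for every choice of the orthonormal bases and of the singular value decomposition made by the algorithm. The first term on the right is $+\infty$ if $f$ is unbounded on $[\lambda_{\min},\lambda_{\max}]$. -/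

import Mathlib

open MeasureTheory ProbabilityTheory Matrix

/-- The Frobenius norm of a real matrix. -/
noncomputable def frobNorm {m n : Type*} [Fintype m] [Fintype n] (M : Matrix m n ℝ) : ℝ :=
  letI := Matrix.frobeniusNormedAddCommGroup (m := m) (n := n) (α := ℝ)
  ‖M‖

/-- The columns of `V` form an orthonormal basis of the range (column space) of `Y`. -/
def IsOrthonormalBasisOfRange {n b m : ℕ} (V : Matrix (Fin n) (Fin b) ℝ)
    (Y : Matrix (Fin n) (Fin m) ℝ) : Prop :=
  Vᵀ * V = 1 ∧ LinearMap.range V.mulVecLin = LinearMap.range Y.mulVecLin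

/-- A transcript, in exact arithmetic, of the block-Lanczos algorithm with matrix `A` and starting
block `Ω`. The run is continued forever, with blocks of width zero once the Krylov spaces are
exhausted; what the algorithm produces in `s` iterations is the initial part of this transcript.
Every choice of the orthonormal bases made along the way is allowed.

Step `i = 0, 1, 2, …` below is iteration `i + 1` of the loop, so `M i` and `R i` are the blocks
usually called `M_{i+1}` and `R_{i+1}`. -/
structure BlockLanczosRun {n ℓ : ℕ} (A : Matrix (Fin n) (Fin n) ℝ)
    (Ω : Matrix (Fin n) (Fin ℓ) ℝ) where
  /-- the width of the block `V i` -/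
  width : ℕ → ℕ
  /-- the blocks of the orthonormal basis -/
  V : (i : ℕ) → Matrix (Fin n) (Fin (width i)) ℝ
  /-- `A V_i - V_{i-1} R_iᵀ`, the first value of the work variable in step `i` -/
  W : (i : ℕ) → Matrix (Fin n) (Fin (width i)) ℝ
  /-- the diagonal blocks of the tridiagonal matrix -/
  M : (i : ℕ) → Matrix (Fin (width i)) (Fin (width i)) ℝ
  /-- the work variable of step `i` after reorthogonalization -/
  Y : (i : ℕ) → Matrix (Fin n) (Fin (width i)) ℝ
  /-- the subdiagonal blocks of the tridiagonal matrix -/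
  R : (i : ℕ) → Matrix (Fin (width (i + 1))) (Fin (width i)) ℝ
  V_zero : IsOrthonormalBasisOfRange (V 0) Ω
  W_zero : W 0 = A * V 0
  W_succ : ∀ i, W (i + 1) = A * V (i + 1) - V i * (R i)ᵀ
  M_eq : ∀ i, M i = (V i)ᵀ * W i
  Y_eq : ∀ i, Y i = (W i - V i * M i) -
    ∑ j ∈ Finset.range (i + 1), V j * ((V j)ᵀ * (W i - V i * M i))
  V_succ : ∀ i, IsOrthonormalBasisOfRange (V (i + 1)) (Y i)
  R_eq : ∀ i, R i = (V (i + 1))ᵀ * Y i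

namespace BlockLanczosRun

variable {n ℓ : ℕ} {A : Matrix (Fin n) (Fin n) ℝ} {Ω : Matrix (Fin n) (Fin ℓ) ℝ}

/-- The index set of the columns of `Q_s = [V_0 ⋯ V_{s-1}]`: pairs of a block number and a column
of that block. -/
abbrev Idx (L : BlockLanczosRun A Ω) (s : ℕ) : Type := Σ i : Fin s, Fin (L.width i)

/-- The matrix `Q_s = [V_0 ⋯ V_{s-1}]`. -/
def Q (L : BlockLanczosRun A Ω) (s : ℕ) : Matrix (Fin n) (L.Idx s) ℝ :=
  Matrix.of fun x c => L.V c.1 x c.2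

/-- The block tridiagonal matrix `T_s` with diagonal blocks `M`, subdiagonal blocks `R` and
superdiagonal blocks `Rᵀ`. -/
def T (L : BlockLanczosRun A Ω) (s : ℕ) : Matrix (L.Idx s) (L.Idx s) ℝ :=
  Matrix.of fun a c =>
    if h : (a.1 : ℕ) = c.1 then
      L.M c.1 (Fin.cast (congrArg L.width h) a.2) c.2
    else if h : (a.1 : ℕ) = c.1 + 1 then
      L.R c.1 (Fin.cast (congrArg L.width h) a.2) c.2
    else if h : (c.1 : ℕ) = a.1 + 1 then
      L.R a.1 (Fin.cast (congrArg L.width h) c.2) a.2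
    else 0

/-- The inclusion of the columns of `Q_s` among those of `Q_{s+r}` (they come first). -/
def idxIncl (L : BlockLanczosRun A Ω) (s r : ℕ) (c : L.Idx s) : L.Idx (s + r) :=
  ⟨Fin.castAdd r c.1, c.2⟩

/-- The leading principal block `f(T_{s+r})_{1:d,1:d}` of the matrix function `f(T_{s+r})`, where
`d` is the number of columns of `Q_s`, that is, the dimension of the `s`-th Krylov space. -/
noncomputable def X (L : BlockLanczosRun A Ω) (f : ℝ → ℝ) (s r : ℕ) :
    Matrix (L.Idx s) (L.Idx s) ℝ :=
  (cfc f (L.T (s + r))).submatrix (L.idxIncl s r) (L.idxIncl s r)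

end BlockLanczosRun

/-- `C` is a rank-`k` truncation of `B`: there is a singular value decomposition
`B = U diag(σ) Vᵀ`, with `σ` nonnegative and nonincreasing, in which `C` keeps only the `k` leading
terms. (If the `k`-th and the next singular value agree, `B` may have several truncations.) -/
def IsTruncatedSVD {m n : Type*} [Fintype m] [Fintype n] (B : Matrix m n ℝ) (k : ℕ)
    (C : Matrix m n ℝ) : Prop :=
  ∃ (d : ℕ) (U : Matrix m (Fin d) ℝ) (V : Matrix n (Fin d) ℝ) (σ : Fin d → ℝ),
    Uᵀ * U = 1 ∧ Vᵀ * V = 1 ∧ Antitone σ ∧ (∀ i, 0 ≤ σ i) ∧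
    B = U * Matrix.diagonal σ * Vᵀ ∧
    C = U * Matrix.diagonal (fun i : Fin d => if (i : ℕ) < k then σ i else 0) * Vᵀ

/-- `B` is a possible output of rank `k` of the single-vector Krylov-aware low-rank approximation
method with starting vector `w` and degree parameters `s` and `r`: after `k + s + r` iterations of
the Lanczos algorithm started from `w`, it is `Q_{k+s} ⟦X⟧_k Q_{k+s}ᵀ` with
`X = f(T_{k+s+r})_{1:d,1:d}`. -/
def IsSingleVectorKrylovAware {n : ℕ} (A : Matrix (Fin n) (Fin n) ℝ) (f : ℝ → ℝ) (k s r : ℕ)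
    (w : Fin n → ℝ) (B : Matrix (Fin n) (Fin n) ℝ) : Prop :=
  ∃ (L : BlockLanczosRun A (Matrix.replicateCol (Fin 1) w))
    (Xk : Matrix (L.Idx (k + s)) (L.Idx (k + s)) ℝ),
    IsTruncatedSVD (L.X f (k + s) r) k Xk ∧ B = L.Q (k + s) * Xk * (L.Q (k + s))ᵀ

/-- `inf_{p ∈ ℙ_d} sup_{x ∈ [a, b]} |f x - p x|`, which is `∞` if `f` is unbounded on `[a, b]`. -/
noncomputable def polyApproxError (f : ℝ → ℝ) (d : ℕ) (a b : ℝ) : ENNReal :=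
  ⨅ p ∈ Polynomial.degreeLE ℝ (d : WithBot ℕ), ⨆ x ∈ Set.Icc a b, ‖f x - p.eval x‖ₑ

/-- The diagonal matrix `g(Λ_{n∖k}) = diag(g(λ_{k+1}), …, g(λ_n))`. Indices start from `0`, so the
entries of `lam` with index at least `k` are meant. -/
noncomputable def tailDiag {n : ℕ} (lam : Fin n → ℝ) (k : ℕ) (g : ℝ → ℝ) :
    Matrix {i : Fin n // k ≤ (i : ℕ)} {i : Fin n // k ≤ (i : ℕ)} ℝ :=
  Matrix.diagonal fun i => g (lam i)

/-- The quantity `𝓔(s; f)`, the infimum over the polynomials `p` of degree at most `s - 1` of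
`‖p(Λ_{n∖k})‖_F² max_{i ≤ k} |f(λ_i) / p(λ_i)|²`. Polynomials that vanish at one of
`λ_1, …, λ_k` count as giving the value `∞`, that is, they are left out. -/
noncomputable def minRatio {n : ℕ} (lam : Fin n → ℝ) (f : ℝ → ℝ) (k s : ℕ) : ℝ :=
  ⨅ p : {p : Polynomial ℝ // p ∈ Polynomial.degreeLT ℝ s ∧
      ∀ i : Fin n, (i : ℕ) < k → p.eval (lam i) ≠ 0},
    frobNorm (tailDiag lam k fun x => p.1.eval x) ^ 2 *
      ⨆ i : {i : Fin n // (i : ℕ) < k}, |f (lam i) / p.1.eval (lam i)| ^ 2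

/-- The smallest relative gap `|λ_j - λ_i| / |λ_max - λ_min|` between two of `λ_1, …, λ_k` with
different indices. (For `k = 1` there are no such pairs and the value `0` is a convention; it is
used only through its power with exponent `2 (k - 1) = 0`.) -/
noncomputable def gammaMin {n : ℕ} (lam : Fin n → ℝ) (k : ℕ) : ℝ :=
  ⨅ q : {q : Fin n × Fin n // (q.1 : ℕ) < k ∧ (q.2 : ℕ) < k ∧ q.1 ≠ q.2},
    |lam q.1.2 - lam q.1.1| / |(⨆ i, lam i) - ⨅ i, lam i|

/-- The constant `Ĉ_δ = 2π (1 + 6 log(2/δ)) / δ²`. -/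
noncomputable def Chat (δ : ℝ) : ℝ :=
  2 * Real.pi * (1 + 6 * Real.log (2 / δ)) / δ ^ 2

/-! In the eigenbasis the starting vector has coordinates g = Uᵀ w. The Krylov space contains the
vectors q_j(A) w for j among the k leading indices, where q_j = p ℓ_j / (g_j p(λ_j)) and ℓ_j is the
Lagrange basis polynomial of the leading eigenvalues. Their coordinate matrix Z is the identity on
the leading rows, and its tail rows carry the factor p(λ_i), so they are small when p is small on
the tail of the spectrum. If P is the orthogonal projector onto the range of Z, then P f(Λ) P is a
rank-k competitor inside the Krylov space, and `frobNorm_diagonal_sub_proj_sq_le` bounds its squared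
error by the tail of f(Λ) plus four times the weighted tail of Z.

The algorithm truncates X rather than the exact compression Qᵀ f(A) Q. Lanczos compresses
polynomials of degree at most 2r + 1 exactly (`submatrix_aeval_T`), so the two differ by at most
2√(k+s) times the uniform error of approximating f. Optimality of the truncated SVD doubles this,
and the Pythagorean identity `frobNorm_sub_conj_sq` lets it stand outside the square root
(`frobNorm_sub_truncation_le`).

Randomness enters only through g, whose entries are standard Gaussian. With probability at least 1 -
δ the leading entries are not too small and the weighted tail sum of squares is not too large
(`measure_compl_goodStart_le`). This event depends on p, and the infimum over p need not be
attained. The final event is therefore the limsup of the good events of a minimizing sequence: its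
probability is still at least 1 - δ, and on it the bounds can be passed to the limit. -/

/-! ### Frobenius norm and orthogonal projectors -/

section Frobenius

variable {m n p : Type*} [Fintype m] [Fintype n] [Fintype p]

theorem frobNorm_nonneg (M : Matrix m n ℝ) : 0 ≤ frobNorm M := by
  let := Matrix.frobeniusNormedAddCommGroup (m := m) (n := n) (α := ℝ)
  exact norm_nonneg M

theorem frobNorm_add_le (M N : Matrix m n ℝ) : frobNorm (M + N) ≤ frobNorm M + frobNorm N := by
  let := Matrix.frobeniusNormedAddCommGroup (m := m) (n := n) (α := ℝ)
  exact norm_add_le M N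

theorem frobNorm_neg (M : Matrix m n ℝ) : frobNorm (-M) = frobNorm M := by
  let := Matrix.frobeniusNormedAddCommGroup (m := m) (n := n) (α := ℝ)
  exact norm_neg M

theorem frobNorm_sq (M : Matrix m n ℝ) : frobNorm M ^ 2 = ∑ i, ∑ j, M i j ^ 2 := by
  let := Matrix.frobeniusNormedAddCommGroup (m := m) (n := n) (α := ℝ)
  have h : frobNorm M = (∑ i, ∑ j, ‖M i j‖ ^ (2 : ℝ)) ^ (1 / 2 : ℝ) := frobenius_norm_def M
  rw [h, ← Real.sqrt_eq_rpow, Real.sq_sqrt (by positivity)]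
  simp

theorem frobNorm_transpose (M : Matrix m n ℝ) : frobNorm Mᵀ = frobNorm M := by
  rw [← pow_left_inj₀ (frobNorm_nonneg _) (frobNorm_nonneg _) two_ne_zero, frobNorm_sq,
    frobNorm_sq, Finset.sum_comm]
  rfl

theorem frobNorm_sq_eq_trace (M : Matrix m n ℝ) : frobNorm M ^ 2 = (Mᵀ * M).trace := by
  rw [← frobNorm_transpose, frobNorm_sq]
  simp [Matrix.trace, Matrix.mul_apply, pow_two]

theorem frobNorm_le_of_sq_le {q : Type*} [Fintype q] {M : Matrix m n ℝ} {N : Matrix p q ℝ}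
    (h : frobNorm M ^ 2 ≤ frobNorm N ^ 2) : frobNorm M ≤ frobNorm N :=
  (pow_le_pow_iff_left₀ (frobNorm_nonneg _) (frobNorm_nonneg _) two_ne_zero).1 h

theorem frobNorm_mul_of_transpose_mul_self [DecidableEq n] {Q : Matrix m n ℝ} (hQ : Qᵀ * Q = 1)
    (M : Matrix n p ℝ) : frobNorm (Q * M) = frobNorm M := by
  rw [← pow_left_inj₀ (frobNorm_nonneg _) (frobNorm_nonneg _) two_ne_zero, frobNorm_sq_eq_trace,
    frobNorm_sq_eq_trace, Matrix.transpose_mul, Matrix.mul_assoc, ← Matrix.mul_assoc Qᵀ, hQ,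
    Matrix.one_mul]

theorem frobNorm_mul_transpose_of_transpose_mul_self [DecidableEq n] {Q : Matrix m n ℝ}
    (hQ : Qᵀ * Q = 1) (M : Matrix p n ℝ) : frobNorm (M * Qᵀ) = frobNorm M := by
  rw [← frobNorm_transpose, Matrix.transpose_mul, Matrix.transpose_transpose,
    frobNorm_mul_of_transpose_mul_self hQ, frobNorm_transpose]

/-- The Pythagorean identity for an orthogonal projector acting from the left. -/
theorem frobNorm_proj_mul_sq [DecidableEq m] {P : Matrix m m ℝ} (hT : Pᵀ = P) (hP : P * P = P)
    (M : Matrix m n ℝ) :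
    frobNorm M ^ 2 = frobNorm (P * M) ^ 2 + frobNorm ((1 - P) * M) ^ 2 := by
  simp only [frobNorm_sq_eq_trace, Matrix.transpose_mul, Matrix.transpose_sub, hT,
    Matrix.transpose_one, ← Matrix.trace_add]
  have h1 : Mᵀ * P * (P * M) = Mᵀ * (P * M) := by
    rw [Matrix.mul_assoc, ← Matrix.mul_assoc P, hP]
  have h2 : (1 - P) * (1 - P) = 1 - P := by
    simp [Matrix.sub_mul, Matrix.mul_sub, hP]
  have h3 : Mᵀ * (1 - P) * ((1 - P) * M) = Mᵀ * ((1 - P) * M) := by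
    rw [Matrix.mul_assoc, ← Matrix.mul_assoc (1 - P), h2]
  rw [h1, h3, Matrix.sub_mul, Matrix.mul_sub, Matrix.one_mul]
  congr 1
  abel

theorem frobNorm_mul_proj_sq [DecidableEq m] {P : Matrix m m ℝ} (hT : Pᵀ = P) (hP : P * P = P)
    (M : Matrix n m ℝ) :
    frobNorm M ^ 2 = frobNorm (M * P) ^ 2 + frobNorm (M * (1 - P)) ^ 2 := by
  have := frobNorm_proj_mul_sq hT hP Mᵀ
  rw [← frobNorm_transpose (M * P), ← frobNorm_transpose (M * (1 - P))]
  simpa [Matrix.transpose_mul, hT, frobNorm_transpose] using this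

theorem frobNorm_proj_mul_le [DecidableEq m] {P : Matrix m m ℝ} (hT : Pᵀ = P) (hP : P * P = P)
    (M : Matrix m n ℝ) : frobNorm (P * M) ≤ frobNorm M :=
  frobNorm_le_of_sq_le (by
    rw [frobNorm_proj_mul_sq hT hP M]; exact le_add_of_nonneg_right (sq_nonneg _))

theorem frobNorm_mul_proj_le [DecidableEq m] {P : Matrix m m ℝ} (hT : Pᵀ = P) (hP : P * P = P)
    (M : Matrix n m ℝ) : frobNorm (M * P) ≤ frobNorm M := by
  rw [← frobNorm_transpose, ← frobNorm_transpose M, Matrix.transpose_mul, hT]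
  exact frobNorm_proj_mul_le hT hP _

theorem one_sub_proj [DecidableEq m] {P : Matrix m m ℝ} (hT : Pᵀ = P) (hP : P * P = P) :
    (1 - P)ᵀ = 1 - P ∧ (1 - P) * (1 - P) = 1 - P := by
  constructor
  · simp [hT]
  · simp [Matrix.sub_mul, Matrix.mul_sub, hP]

theorem proj_of_transpose_mul_self [DecidableEq n] {Q : Matrix m n ℝ} (hQ : Qᵀ * Q = 1) :
    (Q * Qᵀ)ᵀ = Q * Qᵀ ∧ (Q * Qᵀ) * (Q * Qᵀ) = Q * Qᵀ := by
  constructor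
  · simp [Matrix.transpose_mul]
  · rw [Matrix.mul_assoc, ← Matrix.mul_assoc Qᵀ, hQ, Matrix.one_mul]

theorem frobNorm_transpose_mul_le [DecidableEq m] [DecidableEq n] {Q : Matrix m n ℝ}
    (hQ : Qᵀ * Q = 1) (M : Matrix m p ℝ) : frobNorm (Qᵀ * M) ≤ frobNorm M := by
  rw [← frobNorm_mul_of_transpose_mul_self hQ, ← Matrix.mul_assoc]
  exact frobNorm_proj_mul_le (proj_of_transpose_mul_self hQ).1 (proj_of_transpose_mul_self hQ).2 M

/-- The Pythagorean identity for the compression to the range of `Q`. -/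
theorem frobNorm_sub_conj_sq [DecidableEq m] [DecidableEq n] {Q : Matrix m n ℝ} (hQ : Qᵀ * Q = 1)
    (M : Matrix m m ℝ) (C : Matrix n n ℝ) :
    frobNorm (M - Q * C * Qᵀ) ^ 2 =
      frobNorm (M - Q * (Qᵀ * M * Q) * Qᵀ) ^ 2 + frobNorm (Qᵀ * M * Q - C) ^ 2 := by
  obtain ⟨hT, hP⟩ := proj_of_transpose_mul_self hQ
  -- Only the first term depends on C; choosing C = Qᵀ M Q isolates the other two.
  have key : ∀ C : Matrix n n ℝ, frobNorm (M - Q * C * Qᵀ) ^ 2 =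
      frobNorm (Qᵀ * M * Q - C) ^ 2 + frobNorm (Q * Qᵀ * M * (1 - Q * Qᵀ)) ^ 2 +
        frobNorm ((1 - Q * Qᵀ) * M) ^ 2 := by
    intro C
    rw [frobNorm_proj_mul_sq hT hP, frobNorm_mul_proj_sq hT hP (Q * Qᵀ * _)]
    have e1 : Q * Qᵀ * (M - Q * C * Qᵀ) * (Q * Qᵀ) = Q * (Qᵀ * M * Q - C) * Qᵀ := by
      have : ∀ X : Matrix n m ℝ, Qᵀ * (Q * X) = X := fun X => by
        rw [← Matrix.mul_assoc, hQ, Matrix.one_mul]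
      simp [Matrix.mul_sub, Matrix.sub_mul, Matrix.mul_assoc, this]
    have e2 : Q * Qᵀ * (M - Q * C * Qᵀ) * (1 - Q * Qᵀ) = Q * Qᵀ * M * (1 - Q * Qᵀ) := by
      have h : Qᵀ * (1 - Q * Qᵀ) = 0 := by
        rw [Matrix.mul_sub, ← Matrix.mul_assoc, hQ]; simp
      rw [Matrix.mul_sub (Q * Qᵀ) M, Matrix.sub_mul (Q * Qᵀ * M)]
      simp [Matrix.mul_assoc, h]
    have e3 : (1 - Q * Qᵀ) * (M - Q * C * Qᵀ) = (1 - Q * Qᵀ) * M := by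
      have h : (1 - Q * Qᵀ) * Q = 0 := by
        rw [Matrix.sub_mul, Matrix.mul_assoc, hQ]; simp
      rw [Matrix.mul_sub, ← Matrix.mul_assoc, ← Matrix.mul_assoc, h]
      simp
    rw [e1, e2, e3, frobNorm_mul_transpose_of_transpose_mul_self hQ,
      frobNorm_mul_of_transpose_mul_self hQ]
  rw [key C, key]
  have : frobNorm (0 : Matrix n n ℝ) ^ 2 = 0 := by rw [frobNorm_sq]; simp
  rw [sub_self, this]
  ring

end Frobenius

/-! ### Optimality of the truncated SVD -/

section Truncation

/-- A limited budget of weights, each at most 1, is best spent on the largest values. The proof uses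
the threshold a = τ_k: the product (τ_i - a)(c_i - 1_{i<k}) is never positive. -/
theorem sum_mul_le_sum_of_antitone {d k : ℕ} {τ c : Fin d → ℝ} (hτ : Antitone τ)
    (hτ0 : ∀ i, 0 ≤ τ i) (hc0 : ∀ i, 0 ≤ c i) (hc1 : ∀ i, c i ≤ 1) (hc : ∑ i, c i ≤ k) :
    ∑ i, τ i * c i ≤ ∑ i : Fin d, if (i : ℕ) < k then τ i else 0 := by
  rcases lt_or_ge k d with hkd | hkd
  · set a := τ ⟨k, hkd⟩
    have h1 : ∀ i : Fin d, τ i * c i ≤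
        (if (i : ℕ) < k then τ i else 0) + a * (c i - if (i : ℕ) < k then 1 else 0) := by
      intro i
      split_ifs with h
      · have : a ≤ τ i := hτ (by simpa [Fin.le_def] using h.le)
        nlinarith [hc1 i]
      · have : τ i ≤ a := hτ (by simpa [Fin.le_def] using not_lt.1 h)
        nlinarith [hc0 i]
    have h2 : ∑ i : Fin d, (if (i : ℕ) < k then (1 : ℝ) else 0) = k := by
      rw [Finset.sum_ite]
      simp only [Finset.sum_const_zero, add_zero, Finset.sum_const, nsmul_eq_mul, mul_one]
      norm_cast
      rw [Fin.card_filter_val_lt, min_eq_right hkd.le]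
    calc _ ≤ _ := Finset.sum_le_sum fun i _ => h1 i
      _ = (∑ i : Fin d, if (i : ℕ) < k then τ i else 0) + a * (∑ i, c i - k) := by
        rw [Finset.sum_add_distrib, ← Finset.mul_sum, Finset.sum_sub_distrib, h2]
      _ ≤ _ := by nlinarith [hτ0 ⟨k, hkd⟩]
  · refine Finset.sum_le_sum fun i _ => ?_
    rw [if_pos (i.2.trans_le hkd)]
    nlinarith [hτ0 i, hc1 i]

theorem frobNorm_mul_diagonal_sq {m : Type*} [Fintype m] {d : ℕ} (M : Matrix m (Fin d) ℝ)
    (σ : Fin d → ℝ) :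
    frobNorm (M * diagonal σ) ^ 2 = ∑ i, σ i ^ 2 * ∑ a, M a i ^ 2 := by
  rw [frobNorm_sq, Finset.sum_comm]
  simp only [Matrix.mul_diagonal, mul_pow, Finset.mul_sum]
  exact Finset.sum_congr rfl fun _ _ => Finset.sum_congr rfl fun _ _ => mul_comm _ _

/-- A truncated singular value decomposition is at least as good in the Frobenius norm as any
matrix whose columns lie in the range of an orthogonal projector of rank at most `k`. -/
theorem IsTruncatedSVD.frobNorm_sub_le {m n : Type*} [Fintype m] [Fintype n] [DecidableEq m]
    [DecidableEq n]
    {B Bk C : Matrix m n ℝ} {k : ℕ} (h : IsTruncatedSVD B k Bk) {P : Matrix m m ℝ} (hT : Pᵀ = P)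
    (hP : P * P = P) (htr : P.trace ≤ k) (hC : P * C = C) :
    frobNorm (B - Bk) ≤ frobNorm (B - C) := by
  obtain ⟨d, U, V, σ, hU, hV, hσ, hσ0, rfl, rfl⟩ := h
  apply frobNorm_le_of_sq_le
  set B := U * diagonal σ * Vᵀ
  have h1 : frobNorm ((1 - P) * B) ^ 2 ≤ frobNorm (B - C) ^ 2 := by
    have h2 : (1 - P) * B = (1 - P) * (B - C) := by
      rw [Matrix.mul_sub (1 - P), Matrix.sub_mul 1 P C, hC, Matrix.one_mul, sub_self, sub_zero]
    rw [h2]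
    exact pow_le_pow_left₀ (frobNorm_nonneg _)
      (frobNorm_proj_mul_le (one_sub_proj hT hP).1 (one_sub_proj hT hP).2 _) 2
  refine le_trans ?_ h1
  have hB : frobNorm B ^ 2 = ∑ i, σ i ^ 2 := by
    rw [frobNorm_mul_transpose_of_transpose_mul_self hV, frobNorm_mul_of_transpose_mul_self hU,
      frobNorm_sq]
    simp [Matrix.diagonal_apply, ite_pow]
  have hS : frobNorm (B - U * diagonal (fun i : Fin d => if (i : ℕ) < k then σ i else 0) * Vᵀ) ^ 2
      = ∑ i, σ i ^ 2 - ∑ i : Fin d, if (i : ℕ) < k then σ i ^ 2 else 0 := by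
    rw [← Matrix.sub_mul, ← Matrix.mul_sub, frobNorm_mul_transpose_of_transpose_mul_self hV,
      frobNorm_mul_of_transpose_mul_self hU, Matrix.diagonal_sub, frobNorm_sq,
      ← Finset.sum_sub_distrib]
    refine Finset.sum_congr rfl fun i _ => ?_
    rw [Finset.sum_eq_single i (fun j _ hj => by simp [hj.symm]) (by simp)]
    simp only [Matrix.diagonal_apply_eq]
    split_ifs <;> simp
  -- The weights of the squared singular values are ‖P u_i‖²: each is at most 1, and they sum to at
  -- most tr P ≤ k.
  have hPB : frobNorm (P * B) ^ 2 = ∑ i, σ i ^ 2 * ∑ a, (P * U) a i ^ 2 := by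
    rw [← Matrix.mul_assoc, ← Matrix.mul_assoc, frobNorm_mul_transpose_of_transpose_mul_self hV,
      frobNorm_mul_diagonal_sq]
  have hcol : ∀ i, ∑ a, (P * U) a i ^ 2 ≤ 1 := by
    intro i
    have h3 := frobNorm_proj_mul_le hT hP (U * Matrix.of fun j (_ : Unit) => if j = i then (1:ℝ) else 0)
    rw [frobNorm_mul_of_transpose_mul_self hU] at h3
    have h4 := pow_le_pow_left₀ (frobNorm_nonneg _) h3 2
    rw [← Matrix.mul_assoc, frobNorm_sq, frobNorm_sq] at h4
    simpa [Matrix.mul_apply (M := P * U)] using h4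
  have htot : ∑ i, ∑ a, (P * U) a i ^ 2 ≤ k := by
    have h5 : frobNorm P ^ 2 = P.trace := by rw [frobNorm_sq_eq_trace, hT, hP]
    refine le_trans ?_ htr
    rw [Finset.sum_comm, ← frobNorm_sq, ← h5, ← frobNorm_transpose, Matrix.transpose_mul, hT]
    exact pow_le_pow_left₀ (frobNorm_nonneg _) (frobNorm_transpose_mul_le hU P) 2
  have key := sum_mul_le_sum_of_antitone (τ := fun i => σ i ^ 2) (k := k)
    (fun i j hij => pow_le_pow_left₀ (hσ0 j) (hσ hij) 2) (fun i => sq_nonneg _)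
    (fun i => Finset.sum_nonneg fun a _ => sq_nonneg _) hcol htot
  have hpy := frobNorm_proj_mul_sq hT hP B
  rw [hB, hPB] at hpy
  rw [hS]
  linarith

end Truncation

/-! ### Orthogonal projector with the range of an oblique one -/

section Structural

variable {ι : Type*} [Fintype ι] [DecidableEq ι]

/-- The orthogonal projector onto the range of a matrix `Z` with `J Z = J`, `Z J = Z`, where `J` is
a coordinate projector. -/
theorem exists_proj_of_oblique {J Z : Matrix ι ι ℝ} (hJT : Jᵀ = J) (hJ : J * J = J)
    (hJZ : J * Z = J) (hZJ : Z * J = Z) :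
    ∃ P : Matrix ι ι ℝ, Pᵀ = P ∧ P * P = P ∧ P * Z = Z ∧ Z * P = P ∧ P.trace = J.trace ∧
      ∃ B, P = Z * B := by
  have hF : (Z - J) * J = Z - J := by rw [Matrix.sub_mul, hZJ, hJ]
  have hZZ : Z * Z = Z := by
    conv_lhs => rw [← hZJ, Matrix.mul_assoc, ← Matrix.mul_assoc J, hJZ, hJ, hZJ]
  set F := Z - J with hFdef
  -- Zᵀ Z itself is singular off the range of J. G repairs this by acting there as the identity, so
  -- Z G⁻¹ Zᵀ serves as the projector.
  set G := 1 + Fᵀ * F with hG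
  have hpd : G.PosDef := by
    apply Matrix.PosDef.add_posSemidef Matrix.PosDef.one
    exact Matrix.posSemidef_conjTranspose_mul_self F
  have hdet : IsUnit G.det := (Matrix.isUnit_iff_isUnit_det _).1 hpd.isUnit
  have hGT : Gᵀ = G := by simp [hG, Matrix.transpose_mul]
  have hJZT : Zᵀ * J = J := by
    rw [← Matrix.transpose_inj, Matrix.transpose_mul, hJT, Matrix.transpose_transpose, hJZ]
  have hZtZ : Zᵀ * Z = G - (1 - J) := by
    rw [hG, hFdef, Matrix.transpose_sub, hJT]
    simp only [Matrix.sub_mul, Matrix.mul_sub, hJZ, hJZT, hJ]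
    abel
  have hG1 : G * (1 - J) = 1 - J := by
    rw [hG, Matrix.add_mul, Matrix.mul_assoc, Matrix.mul_sub F, hF]
    simp
  have hGi : G⁻¹ * (1 - J) = 1 - J := by
    conv_lhs => rw [← hG1, ← Matrix.mul_assoc, Matrix.nonsing_inv_mul _ hdet, Matrix.one_mul]
  have hPZ : Z * G⁻¹ * Zᵀ * Z = Z := by
    rw [Matrix.mul_assoc, hZtZ, Matrix.mul_sub, Matrix.mul_assoc, Matrix.nonsing_inv_mul _ hdet,
      Matrix.mul_assoc, hGi, Matrix.mul_sub, hZJ]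
    simp
  have hZP : Z * (Z * G⁻¹ * Zᵀ) = Z * G⁻¹ * Zᵀ := by
    rw [← Matrix.mul_assoc, ← Matrix.mul_assoc, hZZ]
  refine ⟨Z * G⁻¹ * Zᵀ, ?_, ?_, hPZ, hZP, ?_, G⁻¹ * Zᵀ, Matrix.mul_assoc _ _ _⟩
  · rw [Matrix.transpose_mul, Matrix.transpose_mul, Matrix.transpose_transpose,
      Matrix.transpose_nonsing_inv, hGT, Matrix.mul_assoc]
  · conv_lhs => rw [← Matrix.mul_assoc, ← Matrix.mul_assoc, hPZ]
  -- tr P = tr ZP = tr PZ = tr Z = tr ZJ = tr JZ = tr J.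
  · rw [← hZP, Matrix.trace_mul_comm, hPZ]
    nth_rw 1 [← hZJ]
    rw [Matrix.trace_mul_comm, hJZ]

end Structural

/-! ### Error of the two-sided projection of a diagonal matrix -/

section StructuralBound

variable {n : ℕ}

/-- The structural bound for the two-sided projection of a diagonal matrix. -/
theorem frobNorm_diagonal_sub_proj_sq_le {k : ℕ} {d : Fin n → ℝ} {Z P : Matrix (Fin n) (Fin n) ℝ}
    (hd : ∀ i j : Fin n, (j : ℕ) < k → k ≤ (i : ℕ) → |d i| ≤ |d j|)
    (hZ1 : ∀ i j : Fin n, (i : ℕ) < k → (j : ℕ) < k → Z i j = if i = j then 1 else 0)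
    (hZ0 : ∀ i j : Fin n, k ≤ (j : ℕ) → Z i j = 0)
    (hT : Pᵀ = P) (hP : P * P = P) (hPZ : P * Z = Z) (hZP : Z * P = P) :
    frobNorm (diagonal d - P * diagonal d * P) ^ 2 ≤
      (∑ i : Fin n, if k ≤ (i : ℕ) then d i ^ 2 else 0) +
        4 * ∑ i : Fin n, ∑ j : Fin n, if k ≤ (i : ℕ) ∧ (j : ℕ) < k then (Z i j * d j) ^ 2 else 0 := by
  set d1 : Fin n → ℝ := fun i => if (i : ℕ) < k then d i else 0 with hd1
  set d2 : Fin n → ℝ := fun i => if (i : ℕ) < k then 0 else d i with hd2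
  set D1 := diagonal d1
  set D2 := diagonal d2
  have hD : diagonal d = D1 + D2 := by
    rw [Matrix.diagonal_add]
    congr 1; ext i; simp only [hd1, hd2]; split_ifs <;> simp
  set g2 := ∑ i : Fin n, ∑ j : Fin n, if k ≤ (i : ℕ) ∧ (j : ℕ) < k then (Z i j * d j) ^ 2 else 0
    with hg2
  obtain ⟨hT', hP'⟩ := one_sub_proj hT hP
  -- the contribution of the leading part
  have ha : frobNorm ((1 - P) * D1) ^ 2 ≤ g2 := by
    -- Since 1 - P annihilates Z, the leading part may be replaced by Z D1 - D1, whose only nonzero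
    -- block is the tail of Z weighted by d.
    have e : (1 - P) * D1 = -((1 - P) * (Z * D1 - D1)) := by
      have : (1 - P) * (Z * D1) = 0 := by
        rw [← Matrix.mul_assoc, Matrix.sub_mul, hPZ]; simp
      rw [Matrix.mul_sub (1 - P), this]; simp
    rw [e, frobNorm_neg]
    refine (pow_le_pow_left₀ (frobNorm_nonneg _) (frobNorm_proj_mul_le hT' hP' _) 2).trans ?_
    rw [frobNorm_sq]
    refine Finset.sum_le_sum fun i _ => Finset.sum_le_sum fun j _ => le_of_eq ?_
    simp only [Matrix.sub_apply, D1, Matrix.mul_diagonal, Matrix.diagonal_apply, hd1]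
    by_cases hj : (j : ℕ) < k
    · by_cases hi : (i : ℕ) < k
      · rw [hZ1 i j hi hj]
        by_cases hij : i = j
        · subst hij; simp [hi]
        · simp [hij, not_le.2 hi]
      · have hij : i ≠ j := fun h => hi (h ▸ hj)
        simp [hij, hj, not_lt.1 hi]
    · by_cases hij : i = j
      · subst hij; simp [hj]
      · simp [hij, hj]
  -- Writing P = Z P gives the weights d_i with i in the tail; the ordering of |d| replaces them by
  -- the leading d_j.
  have hb : frobNorm (D2 * P) ^ 2 ≤ g2 := by
    rw [← hZP, ← Matrix.mul_assoc]
    refine (pow_le_pow_left₀ (frobNorm_nonneg _) (frobNorm_mul_proj_le hT hP _) 2).trans ?_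
    rw [frobNorm_sq]
    refine Finset.sum_le_sum fun i _ => Finset.sum_le_sum fun j _ => ?_
    simp only [D2, Matrix.diagonal_mul, hd2]
    by_cases hi : (i : ℕ) < k
    · simp [hi, not_le.2 hi]
    · by_cases hj : (j : ℕ) < k
      · simp only [hi, hj, not_lt.1 hi, if_false, and_self, if_true]
        rw [mul_comm, mul_pow, mul_pow]
        exact mul_le_mul_of_nonneg_left (sq_le_sq.2 (hd i j hj (not_lt.1 hi))) (sq_nonneg _)
      · simp [hZ0 i j (not_lt.1 hj), hj]
  set a := frobNorm ((1 - P) * D1)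
  set b := frobNorm (D2 * P)
  have hpy : frobNorm (diagonal d - P * diagonal d * P) ^ 2 =
      frobNorm ((1 - P) * diagonal d) ^ 2 + frobNorm ((1 - P) * diagonal d * P) ^ 2 := by
    rw [frobNorm_proj_mul_sq hT hP, add_comm]
    congr 2
    · rw [Matrix.mul_sub, ← Matrix.mul_assoc (1 - P), ← Matrix.mul_assoc (1 - P),
        Matrix.sub_mul 1 P P, hP]
      simp
    · rw [← frobNorm_transpose]
      congr 1
      rw [Matrix.mul_sub, ← Matrix.mul_assoc P, ← Matrix.mul_assoc P, hP]
      simp only [Matrix.transpose_sub, Matrix.transpose_mul, Matrix.diagonal_transpose, hT,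
        Matrix.sub_mul, Matrix.one_mul, Matrix.mul_assoc]
  have h1 : frobNorm ((1 - P) * diagonal d) ^ 2 =
      a ^ 2 + ((∑ i : Fin n, if k ≤ (i : ℕ) then d i ^ 2 else 0) - b ^ 2) := by
    have e1 : frobNorm ((1 - P) * diagonal d) ^ 2 = a ^ 2 + frobNorm ((1 - P) * D2) ^ 2 := by
      rw [hD, Matrix.mul_add, frobNorm_sq, frobNorm_sq, frobNorm_sq, ← Finset.sum_add_distrib]
      refine Finset.sum_congr rfl fun i _ => ?_
      rw [← Finset.sum_add_distrib]
      refine Finset.sum_congr rfl fun j _ => ?_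
      simp only [Matrix.add_apply, D1, D2, Matrix.mul_diagonal, hd1, hd2]
      split_ifs <;> simp
    have e2 : frobNorm D2 ^ 2 = ∑ i : Fin n, if k ≤ (i : ℕ) then d i ^ 2 else 0 := by
      rw [frobNorm_sq]
      refine Finset.sum_congr rfl fun i _ => ?_
      rw [Finset.sum_eq_single i (fun j _ hj => by simp [D2, hj.symm]) (by simp)]
      simp only [D2, Matrix.diagonal_apply_eq, hd2]
      by_cases hi : (i : ℕ) < k
      · simp [hi, not_le.2 hi]
      · simp [hi, not_lt.1 hi]
    have e3 := frobNorm_proj_mul_sq hT hP D2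
    have e4 : frobNorm (P * D2) = b := by
      rw [← frobNorm_transpose, Matrix.transpose_mul, hT, Matrix.diagonal_transpose]
    rw [e4, e2] at e3
    rw [e1]
    linarith
  have h2 : frobNorm ((1 - P) * diagonal d * P) ≤ a + b := by
    rw [hD, Matrix.mul_add, Matrix.add_mul]
    refine (frobNorm_add_le _ _).trans (add_le_add (frobNorm_mul_proj_le hT hP _) ?_)
    rw [Matrix.mul_assoc]
    exact frobNorm_proj_mul_le hT' hP' _
  have h3 := pow_le_pow_left₀ (frobNorm_nonneg _) h2 2
  rw [hpy, h1]
  -- The -b² gained from the tail cancels the b² in (a + b)². What remains is 2a² + 2ab ≤ 3a² + b² ≤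
  -- 4 g2.
  nlinarith [sq_nonneg (a - b)]

end StructuralBound

/-! ### Block Lanczos: orthogonality, Krylov inclusions, exactness -/

section Lanczos

theorem exists_eq_mul_of_range_le {n b m : Type*} [Fintype n] [Fintype b] [Fintype m]
    [DecidableEq m] {V : Matrix n b ℝ} {Y : Matrix n m ℝ}
    (h : LinearMap.range Y.mulVecLin ≤ LinearMap.range V.mulVecLin) :
    ∃ K : Matrix b m ℝ, Y = V * K := by
  have h1 : ∀ j : m, ∃ x : b → ℝ, V *ᵥ x = Y *ᵥ Pi.single j 1 := fun j =>
    h ⟨Pi.single j 1, rfl⟩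
  choose x hx using h1
  refine ⟨Matrix.of fun i j => x j i, ?_⟩
  ext a j
  have := congrFun (hx j) a
  rw [Matrix.mulVec_single_one] at this
  simpa [Matrix.mul_apply, Matrix.mulVec, dotProduct] using this.symm

theorem IsOrthonormalBasisOfRange.exists_eq_mul {n b m : ℕ} {V : Matrix (Fin n) (Fin b) ℝ}
    {Y : Matrix (Fin n) (Fin m) ℝ} (h : IsOrthonormalBasisOfRange V Y) :
    ∃ K : Matrix (Fin m) (Fin b) ℝ, V = Y * K :=
  exists_eq_mul_of_range_le h.2.le

theorem IsOrthonormalBasisOfRange.mul_transpose_mul {n b m : ℕ} {V : Matrix (Fin n) (Fin b) ℝ}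
    {Y : Matrix (Fin n) (Fin m) ℝ} (h : IsOrthonormalBasisOfRange V Y) : V * (Vᵀ * Y) = Y := by
  obtain ⟨K, rfl⟩ := exists_eq_mul_of_range_le h.2.ge
  rw [← Matrix.mul_assoc Vᵀ, h.1, Matrix.one_mul]

theorem IsOrthonormalBasisOfRange.width_le {n b m : ℕ} {V : Matrix (Fin n) (Fin b) ℝ}
    {Y : Matrix (Fin n) (Fin m) ℝ} (h : IsOrthonormalBasisOfRange V Y) : b ≤ m := by
  obtain ⟨K, hK⟩ := h.exists_eq_mul
  have h1 : (Vᵀ * Y) * K = 1 := by rw [Matrix.mul_assoc, ← hK, h.1]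
  have h2 := Matrix.rank_mul_le_right (Vᵀ * Y) K
  rw [h1, Matrix.rank_one] at h2
  simpa using h2.trans (Matrix.rank_le_height K)

namespace BlockLanczosRun

variable {n ℓ : ℕ} {A : Matrix (Fin n) (Fin n) ℝ} {Ω : Matrix (Fin n) (Fin ℓ) ℝ}
  (L : BlockLanczosRun A Ω)

theorem V_transpose_mul_self (i : ℕ) : (L.V i)ᵀ * L.V i = 1 := by
  cases i with
  | zero => exact L.V_zero.1
  | succ i => exact (L.V_succ i).1

/-- Reorthogonalization removes from Y_N its components along the earlier blocks, which are mutually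
orthogonal by induction, and V_{N+1} = Y_N K inherits the orthogonality. -/
theorem V_orthogonal_aux (N : ℕ) : ∀ j ≤ N, ∀ i < j, (L.V i)ᵀ * L.V j = 0 := by
  induction N with
  | zero => intro j hj i hi; omega
  | succ N ih =>
    intro j hj i hi
    rcases Nat.lt_or_ge j (N + 1) with h | h
    · exact ih j (Nat.lt_succ_iff.1 h) i hi
    obtain rfl : j = N + 1 := le_antisymm hj h
    have hY : (L.V i)ᵀ * L.Y N = 0 := by
      rw [L.Y_eq, Matrix.mul_sub (L.V i)ᵀ, Matrix.mul_sum,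
        Finset.sum_eq_single_of_mem i (Finset.mem_range.2 hi)]
      · rw [← Matrix.mul_assoc (L.V i)ᵀ (L.V i), L.V_transpose_mul_self, Matrix.one_mul, sub_self]
      · intro m hm hmi
        have : (L.V i)ᵀ * L.V m = 0 := by
          rcases lt_or_gt_of_ne hmi with h' | h'
          · rw [← Matrix.transpose_inj, Matrix.transpose_mul, Matrix.transpose_transpose,
              ih i (by omega) m h', Matrix.transpose_zero]
          · exact ih m (by rw [Finset.mem_range] at hm; omega) i h'
        rw [← Matrix.mul_assoc, this, Matrix.zero_mul]
    obtain ⟨K, hK⟩ := (L.V_succ N).exists_eq_mul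
    rw [hK, ← Matrix.mul_assoc, hY, Matrix.zero_mul]

theorem V_orthogonal {i j : ℕ} (h : i ≠ j) : (L.V i)ᵀ * L.V j = 0 := by
  rcases lt_or_gt_of_ne h with h' | h'
  · exact L.V_orthogonal_aux j j le_rfl i h'
  · rw [← Matrix.transpose_inj, Matrix.transpose_mul, Matrix.transpose_transpose,
      L.V_orthogonal_aux i i le_rfl j h', Matrix.transpose_zero]

/-- The three-term recurrence with unspecified coefficients for the earlier blocks. -/
theorem exists_mul_V_eq (i : ℕ) : ∃ C : (j : ℕ) → Matrix (Fin (L.width j)) (Fin (L.width i)) ℝ,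
    A * L.V i = L.V (i + 1) * L.R i + ∑ j ∈ Finset.range (i + 1), L.V j * C j := by
  have hY : L.V (i + 1) * L.R i = L.Y i := by rw [L.R_eq, (L.V_succ i).mul_transpose_mul]
  have hsingle : ∀ m < i + 1, ∀ X : Matrix (Fin (L.width m)) (Fin (L.width i)) ℝ,
      ∃ C : (j : ℕ) → Matrix (Fin (L.width j)) (Fin (L.width i)) ℝ,
        L.V m * X = ∑ j ∈ Finset.range (i + 1), L.V j * C j := by
    intro m hm X
    refine ⟨fun j => if h : j = m then h ▸ X else 0, ?_⟩
    rw [Finset.sum_eq_single_of_mem m (Finset.mem_range.2 hm)]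
    · simp
    · intro j _ hj; simp [hj]
  have hW : ∃ C : (j : ℕ) → Matrix (Fin (L.width j)) (Fin (L.width i)) ℝ,
      A * L.V i = L.W i + ∑ j ∈ Finset.range (i + 1), L.V j * C j := by
    cases i with
    | zero => exact ⟨fun _ => 0, by simp [L.W_zero]⟩
    | succ i =>
      obtain ⟨C, hC⟩ := hsingle i (by omega) (L.R i)ᵀ
      exact ⟨C, by rw [← hC, L.W_succ]; abel⟩
  obtain ⟨C1, h1⟩ := hW
  obtain ⟨C2, h2⟩ := hsingle i (by omega) (L.M i)
  refine ⟨fun j => C1 j + C2 j + (L.V j)ᵀ * (L.W i - L.V i * L.M i), ?_⟩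
  simp only [Matrix.mul_add, Finset.sum_add_distrib]
  rw [hY, L.Y_eq, h1, ← h2]
  abel

theorem V_transpose_mul_A_mul_V_succ (i : ℕ) : (L.V (i + 1))ᵀ * (A * L.V i) = L.R i := by
  obtain ⟨C, hC⟩ := L.exists_mul_V_eq i
  rw [hC, Matrix.mul_add, Matrix.mul_sum, ← Matrix.mul_assoc, L.V_transpose_mul_self,
    Matrix.one_mul, Finset.sum_eq_zero, add_zero]
  intro j hj
  rw [Finset.mem_range] at hj
  rw [← Matrix.mul_assoc, L.V_orthogonal (by omega), Matrix.zero_mul]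

theorem V_transpose_mul_A_mul_V_of_lt {i j : ℕ} (h : i + 1 < j) :
    (L.V j)ᵀ * (A * L.V i) = 0 := by
  obtain ⟨C, hC⟩ := L.exists_mul_V_eq i
  rw [hC, Matrix.mul_add, Matrix.mul_sum, ← Matrix.mul_assoc, L.V_orthogonal (by omega),
    Matrix.zero_mul, Finset.sum_eq_zero, add_zero]
  intro m hm
  rw [Finset.mem_range] at hm
  rw [← Matrix.mul_assoc, L.V_orthogonal (by omega), Matrix.zero_mul]

theorem M_eq_conj (i : ℕ) : (L.V i)ᵀ * (A * L.V i) = L.M i := by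
  rw [L.M_eq]
  cases i with
  | zero => rw [L.W_zero]
  | succ i =>
    rw [L.W_succ, Matrix.mul_sub, ← Matrix.mul_assoc _ (L.V i), L.V_orthogonal (by omega),
      Matrix.zero_mul, sub_zero]

theorem mul_Q_apply {m : Type*} (N : Matrix m (Fin n) ℝ) (s : ℕ) (x : m) (c : L.Idx s) :
    (N * L.Q s) x c = (N * L.V c.1) x c.2 := rfl

theorem Q_transpose_mul_self (s : ℕ) : (L.Q s)ᵀ * L.Q s = 1 := by
  ext ⟨i, a⟩ ⟨j, c⟩
  rw [mul_Q_apply]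
  change ((L.V i)ᵀ * L.V j) a c = _
  by_cases h : i = j
  · subst h
    rw [L.V_transpose_mul_self]
    simp [Matrix.one_apply]
  · rw [L.V_orthogonal (fun h' => h (Fin.ext h'))]
    rw [Matrix.one_apply_ne (by intro h'; exact h (congrArg Sigma.fst h'))]
    rfl

/-- The recurrence and orthogonality determine the blocks on and below the diagonal; symmetry of A
gives those above. -/
theorem Q_transpose_mul_A_mul_Q (hA : Aᵀ = A) (s : ℕ) : (L.Q s)ᵀ * (A * L.Q s) = L.T s := by
  ext ⟨i, a⟩ ⟨j, c⟩
  change ((L.V i)ᵀ * (A * L.V j)) a c = _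
  obtain ⟨i, hi⟩ := i
  obtain ⟨j, hj⟩ := j
  simp only [T, Matrix.of_apply]
  split_ifs with h1 h2 h3
  · subst h1
    rw [L.M_eq_conj]
    rfl
  · subst h2
    rw [L.V_transpose_mul_A_mul_V_succ]
    rfl
  · subst h3
    have : (L.V i)ᵀ * (A * L.V (i + 1)) = (L.R i)ᵀ := by
      rw [← L.V_transpose_mul_A_mul_V_succ]
      simp [Matrix.transpose_mul, hA, Matrix.mul_assoc]
    rw [this]
    rfl
  · rcases lt_or_gt_of_ne h1 with h | h
    · have : (L.V i)ᵀ * (A * L.V j) = 0 := by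
        rw [← Matrix.transpose_inj]
        simp only [Matrix.transpose_mul, hA, Matrix.transpose_transpose, Matrix.mul_assoc]
        rw [L.V_transpose_mul_A_mul_V_of_lt (by omega), Matrix.transpose_zero]
      rw [this]; rfl
    · rw [L.V_transpose_mul_A_mul_V_of_lt (by omega)]; rfl

/-- The selection matrix of the leading columns. -/
def incl (s r : ℕ) : Matrix (L.Idx (s + r)) (L.Idx s) ℝ :=
  (1 : Matrix (L.Idx (s + r)) (L.Idx (s + r)) ℝ).submatrix id (L.idxIncl s r)

theorem Q_mul_incl (s r : ℕ) : L.Q (s + r) * L.incl s r = L.Q s := by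
  ext x c
  simp only [incl, Matrix.mul_apply, Matrix.submatrix_apply, id, Matrix.one_apply, mul_ite, mul_one,
    mul_zero, Finset.sum_ite_eq', Finset.mem_univ, if_true]
  rfl

theorem submatrix_idxIncl (s r : ℕ) (N : Matrix (L.Idx (s + r)) (L.Idx (s + r)) ℝ) :
    N.submatrix (L.idxIncl s r) (L.idxIncl s r) = (L.incl s r)ᵀ * N * L.incl s r := by
  ext a c
  simp [incl, Matrix.mul_apply, Matrix.one_apply]

theorem proj_mul_Q_of_le {s t : ℕ} (h : s ≤ t) : L.Q t * ((L.Q t)ᵀ * L.Q s) = L.Q s := by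
  obtain ⟨r, rfl⟩ := Nat.exists_eq_add_of_le h
  conv_lhs => rw [← L.Q_mul_incl s r, ← Matrix.mul_assoc (L.Q (s + r))ᵀ, L.Q_transpose_mul_self,
    Matrix.one_mul]
  exact L.Q_mul_incl s r

theorem proj_mul_V {i t : ℕ} (h : i < t) : L.Q t * ((L.Q t)ᵀ * L.V i) = L.V i := by
  have h1 := L.proj_mul_Q_of_le (le_refl t)
  ext x a
  have h2 := congrFun (congrFun h1 x) ⟨⟨i, h⟩, a⟩
  rw [← Matrix.mul_assoc, L.mul_Q_apply] at h2
  rw [← Matrix.mul_assoc]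
  exact h2

theorem proj_mul_A_mul_Q (s : ℕ) :
    L.Q (s + 1) * ((L.Q (s + 1))ᵀ * (A * L.Q s)) = A * L.Q s := by
  have h : ∀ i < s, L.Q (s + 1) * ((L.Q (s + 1))ᵀ * (A * L.V i)) = A * L.V i := by
    intro i hi
    obtain ⟨C, hC⟩ := L.exists_mul_V_eq i
    have h1 : ∀ j ≤ s, ∀ K : Matrix (Fin (L.width j)) (Fin (L.width i)) ℝ,
        L.Q (s + 1) * ((L.Q (s + 1))ᵀ * (L.V j * K)) = L.V j * K := by
      intro j hj K
      rw [← Matrix.mul_assoc _ (L.V j), ← Matrix.mul_assoc, L.proj_mul_V (by omega)]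
    rw [hC, Matrix.mul_add, Matrix.mul_add, h1 _ (by omega), Matrix.mul_sum, Matrix.mul_sum]
    congr 1
    refine Finset.sum_congr rfl fun j hj => h1 _ ?_ _
    rw [Finset.mem_range] at hj
    omega
  ext x ⟨i, a⟩
  have := congrFun (congrFun (h i i.2) x) a
  rw [← Matrix.mul_assoc, ← Matrix.mul_assoc, L.mul_Q_apply, L.mul_Q_apply, Matrix.mul_assoc,
    Matrix.mul_assoc]
  exact this

/-- Each multiplication by A costs one further block, because A maps the range of Q_s into that of
Q_{s+1}. -/
theorem proj_mul_pow_mul_Q (s m : ℕ) {t : ℕ} (h : s + m ≤ t) :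
    L.Q t * ((L.Q t)ᵀ * (A ^ m * L.Q s)) = A ^ m * L.Q s := by
  induction m generalizing t with
  | zero => simpa using L.proj_mul_Q_of_le h
  | succ m ih =>
    have h1 : A ^ (m + 1) * L.Q s =
        A * L.Q (s + m) * ((L.Q (s + m))ᵀ * (A ^ m * L.Q s)) := by
      rw [Matrix.mul_assoc, ih le_rfl, pow_succ', Matrix.mul_assoc]
    have h2 : L.Q t * ((L.Q t)ᵀ * (A * L.Q (s + m))) = A * L.Q (s + m) := by
      rw [← L.proj_mul_A_mul_Q (s + m), ← Matrix.mul_assoc (L.Q t)ᵀ, ← Matrix.mul_assoc (L.Q t),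
        L.proj_mul_Q_of_le (s := s + m + 1) h]
    rw [h1, ← Matrix.mul_assoc (L.Q t)ᵀ, ← Matrix.mul_assoc (L.Q t), h2]

/-- Krylov vectors lie in the range of the computed orthonormal basis. -/
theorem proj_mul_aeval_mul {s : ℕ} {p : Polynomial ℝ} (hp : p.natDegree < s) :
    L.Q s * ((L.Q s)ᵀ * (Polynomial.aeval A p * Ω)) = Polynomial.aeval A p * Ω := by
  have hV : L.V 0 * ((L.V 0)ᵀ * Ω) = Ω := L.V_zero.mul_transpose_mul
  have hpow : ∀ m < s, L.Q s * ((L.Q s)ᵀ * (A ^ m * Ω)) = A ^ m * Ω := by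
    intro m hm
    have h1 : L.V 0 = L.Q 1 * ((L.Q 1)ᵀ * L.V 0) := (L.proj_mul_V one_pos).symm
    have h2 : A ^ m * Ω = A ^ m * L.Q 1 * ((L.Q 1)ᵀ * L.V 0 * ((L.V 0)ᵀ * Ω)) := by
      rw [Matrix.mul_assoc, ← Matrix.mul_assoc (L.Q 1), ← h1, hV]
    rw [h2, ← Matrix.mul_assoc (L.Q s)ᵀ, ← Matrix.mul_assoc (L.Q s),
      L.proj_mul_pow_mul_Q 1 m (by omega)]
  rw [Polynomial.aeval_eq_sum_range' hp, Matrix.sum_mul, Matrix.mul_sum, Matrix.mul_sum]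
  refine Finset.sum_congr rfl fun m hm => ?_
  rw [Matrix.smul_mul, Matrix.mul_smul, Matrix.mul_smul, hpow m (Finset.mem_range.1 hm)]

/-- The exponent r + 1 is allowed although A^{r+1} Q_s may leave the range of Q_{s+r}: the last
factor A comes after the last projector that has to be removed. -/
theorem T_pow_mul_incl (hA : Aᵀ = A) (s r : ℕ) {j : ℕ} (hj : j ≤ r + 1) :
    L.T (s + r) ^ j * L.incl s r = (L.Q (s + r))ᵀ * (A ^ j * L.Q s) := by
  induction j with
  | zero =>
    rw [pow_zero, pow_zero, Matrix.one_mul, Matrix.one_mul, ← L.Q_mul_incl s r, ← Matrix.mul_assoc,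
      L.Q_transpose_mul_self, Matrix.one_mul]
  | succ j ih =>
    rw [pow_succ', Matrix.mul_assoc, ih (by omega), ← L.Q_transpose_mul_A_mul_Q hA,
      Matrix.mul_assoc, Matrix.mul_assoc, L.proj_mul_pow_mul_Q s j (by omega), pow_succ',
      Matrix.mul_assoc]

theorem T_transpose (hA : Aᵀ = A) (s : ℕ) : (L.T s)ᵀ = L.T s := by
  rw [← L.Q_transpose_mul_A_mul_Q hA]
  simp [Matrix.transpose_mul, hA, Matrix.mul_assoc]

/-- Lanczos exactness: polynomials of degree at most `2r + 1` of `A` are compressed exactly. -/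
theorem submatrix_aeval_T (hA : Aᵀ = A) (s r : ℕ) {p : Polynomial ℝ}
    (hp : p.natDegree < 2 * r + 2) :
    (Polynomial.aeval (L.T (s + r)) p).submatrix (L.idxIncl s r) (L.idxIncl s r) =
      (L.Q s)ᵀ * Polynomial.aeval A p * L.Q s := by
  have hpow : ∀ m < 2 * r + 2, (L.incl s r)ᵀ * (L.T (s + r)) ^ m * L.incl s r =
      (L.Q s)ᵀ * A ^ m * L.Q s := by
    intro m hm
    -- Splitting the power leaves a projector Q Qᵀ between A^i and A^j. It acts trivially on A^j Q_s
    -- as long as j ≤ r, so only i may reach r + 1, and the exactness degree is 2r + 1.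
    obtain ⟨i, j, hi, hj, rfl⟩ : ∃ i j, i ≤ r + 1 ∧ j ≤ r ∧ m = i + j := by
      rcases Nat.lt_or_ge m (r + 1) with h | h
      · exact ⟨0, m, by omega, by omega, by omega⟩
      · exact ⟨r + 1, m - (r + 1), by omega, by omega, by omega⟩
    have h1 : (L.incl s r)ᵀ * L.T (s + r) ^ i = (L.Q s)ᵀ * (A ^ i * L.Q (s + r)) := by
      have := congrArg Matrix.transpose (L.T_pow_mul_incl hA s r hi)
      simpa [Matrix.transpose_mul, Matrix.transpose_pow, hA, L.T_transpose hA, Matrix.mul_assoc]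
        using this
    rw [pow_add, Matrix.mul_assoc, Matrix.mul_assoc, L.T_pow_mul_incl hA s r (by omega),
      ← Matrix.mul_assoc, h1, Matrix.mul_assoc, Matrix.mul_assoc,
      L.proj_mul_pow_mul_Q s j (by omega), pow_add, Matrix.mul_assoc, Matrix.mul_assoc]
  rw [L.submatrix_idxIncl, Polynomial.aeval_eq_sum_range' hp, Polynomial.aeval_eq_sum_range' hp]
  simp only [Matrix.mul_sum, Matrix.sum_mul, Matrix.mul_smul, Matrix.smul_mul]
  refine Finset.sum_congr rfl fun m hm => ?_
  rw [hpow m (Finset.mem_range.1 hm)]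

theorem width_le (i : ℕ) : L.width i ≤ ℓ := by
  induction i with
  | zero => exact L.V_zero.width_le
  | succ i ih => exact (L.V_succ i).width_le.trans ih

theorem card_Idx_le (s : ℕ) : Fintype.card (L.Idx s) ≤ s * ℓ := by
  rw [Fintype.card_sigma]
  simpa using Finset.sum_le_card_nsmul Finset.univ (fun i : Fin s => L.width i) ℓ
    (fun i _ => L.width_le i)

end BlockLanczosRun

end Lanczos

/-! ### Matrix functions of symmetric matrices -/

section FunctionalCalculus

variable {ι : Type*} [Fintype ι] [DecidableEq ι]

theorem aeval_conj_diagonal {U : Matrix ι ι ℝ} (hU : Uᵀ * U = 1) (lam : ι → ℝ)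
    (p : Polynomial ℝ) :
    Polynomial.aeval (U * diagonal lam * Uᵀ) p = U * diagonal (fun i => p.eval (lam i)) * Uᵀ := by
  have hU' : U * Uᵀ = 1 := mul_eq_one_comm.1 hU
  have hpow : ∀ m : ℕ, (U * diagonal lam * Uᵀ) ^ m = U * diagonal (fun i => lam i ^ m) * Uᵀ := by
    intro m
    induction m with
    | zero => simp [hU']
    | succ m ih =>
      rw [pow_succ, ih]
      have : ∀ X : Matrix ι ι ℝ, Uᵀ * (U * X) = X := fun X => by
        rw [← Matrix.mul_assoc, hU, Matrix.one_mul]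
      simp only [Matrix.mul_assoc, this]
      rw [← Matrix.mul_assoc (diagonal _) (diagonal _), Matrix.diagonal_mul_diagonal]
      simp only [pow_succ]
  induction p using Polynomial.induction_on' with
  | add p q hp hq =>
    rw [map_add, hp, hq, ← Matrix.add_mul, ← Matrix.mul_add, Matrix.diagonal_add]
    simp only [Polynomial.eval_add]
  | monomial m a =>
    rw [Polynomial.aeval_monomial, hpow, ← Algebra.smul_def, ← Matrix.smul_mul, ← Matrix.mul_smul,
      ← Matrix.diagonal_smul]
    simp only [Polynomial.eval_monomial]
    rfl

/-- No continuity of f is needed: the spectrum is finite, so f agrees on it with an interpolating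
polynomial. Interpolating on the image of `lam` accommodates repeated eigenvalues. -/
theorem cfc_conj_diagonal {U : Matrix ι ι ℝ} (hU : Uᵀ * U = 1) (lam : ι → ℝ) (f : ℝ → ℝ) :
    cfc f (U * diagonal lam * Uᵀ) = U * diagonal (fun i => f (lam i)) * Uᵀ := by
  classical
  have hU' : U * Uᵀ = 1 := mul_eq_one_comm.1 hU
  have hspec : spectrum ℝ (U * diagonal lam * Uᵀ) = Set.range lam := by
    have h := spectrum.units_conjugate (R := ℝ) (a := diagonal lam) (u := ⟨U, Uᵀ, hU', hU⟩)
    rw [← spectrum_diagonal]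
    exact h
  have hsa : IsSelfAdjoint (U * diagonal lam * Uᵀ) := by
    rw [isSelfAdjoint_iff, star_eq_conjTranspose, Matrix.conjTranspose_eq_transpose_of_trivial]
    simp [Matrix.transpose_mul, Matrix.mul_assoc]
  set q := Lagrange.interpolate (Finset.univ.image lam) id f with hq
  have hqf : ∀ i, q.eval (lam i) = f (lam i) := fun i =>
    Lagrange.eval_interpolate_at_node (s := Finset.univ.image lam) (v := id) f
      (Set.injOn_id _) (Finset.mem_image_of_mem lam (Finset.mem_univ i))
  have h1 : cfc f (U * diagonal lam * Uᵀ) = cfc q.eval (U * diagonal lam * Uᵀ) := by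
    apply cfc_congr
    rw [hspec]
    rintro _ ⟨i, rfl⟩
    exact (hqf i).symm
  rw [h1, cfc_polynomial q _ hsa, aeval_conj_diagonal hU]
  simp only [hqf]

theorem exists_conj_diagonal {T : Matrix ι ι ℝ} (hT : Tᵀ = T) :
    ∃ (W : Matrix ι ι ℝ) (μ : ι → ℝ), Wᵀ * W = 1 ∧ T = W * diagonal μ * Wᵀ := by
  have h : T.IsHermitian := by
    rw [Matrix.IsHermitian, Matrix.conjTranspose_eq_transpose_of_trivial, hT]
  refine ⟨h.eigenvectorUnitary, h.eigenvalues, ?_, ?_⟩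
  · have := h.eigenvectorUnitary.2
    rw [Matrix.mem_unitaryGroup_iff', star_eq_conjTranspose,
      Matrix.conjTranspose_eq_transpose_of_trivial] at this
    exact this
  · have := h.spectral_theorem
    rw [Unitary.conjStarAlgAut_apply, star_eq_conjTranspose,
      Matrix.conjTranspose_eq_transpose_of_trivial] at this
    exact this

/-- The outer Nᵀ is a contraction and ‖N‖² is the number of columns of N, so the dimension that
enters is that of the small space. -/
theorem frobNorm_conj_diagonal_le {m : Type*} [Fintype m] [DecidableEq m] {N : Matrix ι m ℝ}
    (hN : Nᵀ * N = 1) {g : ι → ℝ} {ε : ℝ} (hg : ∀ i, |g i| ≤ ε) :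
    frobNorm (Nᵀ * diagonal g * N) ≤ √(Fintype.card m) * |ε| := by
  have h1 : frobNorm (Nᵀ * diagonal g * N) ^ 2 ≤ Fintype.card m * ε ^ 2 := by
    rw [Matrix.mul_assoc]
    refine (pow_le_pow_left₀ (frobNorm_nonneg _) (frobNorm_transpose_mul_le hN _) 2).trans ?_
    have h2 : frobNorm N ^ 2 = Fintype.card m := by
      rw [frobNorm_sq_eq_trace, hN, Matrix.trace_one]
    rw [← h2, frobNorm_sq, frobNorm_sq, Finset.sum_mul]
    refine Finset.sum_le_sum fun i _ => ?_
    rw [Finset.sum_mul]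
    refine Finset.sum_le_sum fun j _ => ?_
    rw [Matrix.diagonal_mul, mul_pow, mul_comm]
    exact mul_le_mul_of_nonneg_left (sq_le_sq.2 ((hg i).trans (le_abs_self ε))) (sq_nonneg _)
  rw [← abs_of_nonneg (frobNorm_nonneg _), ← Real.sqrt_sq_eq_abs ε,
    ← Real.sqrt_mul (Nat.cast_nonneg _)]
  exact Real.abs_le_sqrt h1

/-- Ritz values are averages of the eigenvalues with weights N_ij². Hence approximating f on the
spectral interval of A also controls f(T). -/
theorem mem_Icc_of_transpose_mul_diagonal_mul {m : Type*} [Fintype m] [DecidableEq m]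
    {N : Matrix ι m ℝ} (hN : Nᵀ * N = 1) {lam : ι → ℝ} {μ : m → ℝ} {a b : ℝ}
    (h : Nᵀ * diagonal lam * N = diagonal μ) (hlam : ∀ i, lam i ∈ Set.Icc a b) (j : m) :
    μ j ∈ Set.Icc a b := by
  have h1 : ∑ i, N i j ^ 2 = 1 := by
    have := congrFun (congrFun hN j) j
    simpa [Matrix.mul_apply, pow_two] using this
  have h2 : μ j = ∑ i, lam i * N i j ^ 2 := by
    have := congrFun (congrFun h j) j
    rw [Matrix.diagonal_apply_eq, Matrix.mul_apply] at this
    rw [← this]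
    refine Finset.sum_congr rfl fun i _ => ?_
    rw [Matrix.mul_diagonal, Matrix.transpose_apply]
    ring
  rw [h2]
  constructor
  · calc a = ∑ i, a * N i j ^ 2 := by rw [← Finset.mul_sum, h1, mul_one]
      _ ≤ _ := Finset.sum_le_sum fun i _ => mul_le_mul_of_nonneg_right (hlam i).1 (sq_nonneg _)
  · calc _ ≤ ∑ i, b * N i j ^ 2 :=
        Finset.sum_le_sum fun i _ => mul_le_mul_of_nonneg_right (hlam i).2 (sq_nonneg _)
      _ = b := by rw [← Finset.mul_sum, h1, mul_one]

end FunctionalCalculus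

/-! ### Deterministic error bound -/

section Combination

variable {n ℓ : ℕ} {Ω : Matrix (Fin n) (Fin ℓ) ℝ}

/-- The error of the Lanczos approximation of the compressed matrix function. -/
theorem BlockLanczosRun.frobNorm_X_sub_le {A U : Matrix (Fin n) (Fin n) ℝ}
    {lam : Fin n → ℝ} (hU : Uᵀ * U = 1) (hAU : A = U * diagonal lam * Uᵀ)
    (L : BlockLanczosRun A Ω) (f : ℝ → ℝ) (s r : ℕ)
    {p : Polynomial ℝ} (hp : p.natDegree < 2 * r + 2) {a b ε : ℝ}
    (hlam : ∀ i, lam i ∈ Set.Icc a b) (hε : ∀ x ∈ Set.Icc a b, |f x - p.eval x| ≤ ε) :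
    frobNorm (L.X f s r - (L.Q s)ᵀ * cfc f A * L.Q s) ≤
      2 * (√(Fintype.card (L.Idx s)) * |ε|) := by
  have hA : Aᵀ = A := by
    rw [hAU]
    simp [Matrix.transpose_mul, Matrix.mul_assoc]
  have haeval : Polynomial.aeval A p = U * diagonal (fun i => p.eval (lam i)) * Uᵀ := by
    rw [hAU, aeval_conj_diagonal hU]
  have hcfc : cfc f A = U * diagonal (fun i => f (lam i)) * Uᵀ := by
    rw [hAU, cfc_conj_diagonal hU]
  have hU' : U * Uᵀ = 1 := mul_eq_one_comm.1 hU
  obtain ⟨W, μ, hW, hT⟩ := exists_conj_diagonal (L.T_transpose hA (s + r))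
  have hW' : W * Wᵀ = 1 := mul_eq_one_comm.1 hW
  have hμ : ∀ j, μ j ∈ Set.Icc a b := by
    refine mem_Icc_of_transpose_mul_diagonal_mul (N := Uᵀ * (L.Q (s + r) * W)) ?_ ?_ hlam
    · simp only [Matrix.transpose_mul, Matrix.transpose_transpose, Matrix.mul_assoc]
      rw [← Matrix.mul_assoc U, hU', Matrix.one_mul, ← Matrix.mul_assoc _ (L.Q (s + r)),
        L.Q_transpose_mul_self, Matrix.one_mul, hW]
    · have h1 := L.Q_transpose_mul_A_mul_Q hA (s + r)
      have h2 : Wᵀ * L.T (s + r) * W = diagonal μ := by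
        rw [hT]
        simp only [Matrix.mul_assoc]
        rw [hW, Matrix.mul_one, ← Matrix.mul_assoc, hW, Matrix.one_mul]
      have hAQ : A * L.Q (s + r) = U * (diagonal lam * (Uᵀ * L.Q (s + r))) :=
        (congrArg (· * L.Q (s + r)) hAU).trans (by simp only [Matrix.mul_assoc])
      rw [← h2, ← h1, hAQ]
      simp only [Matrix.transpose_mul, Matrix.transpose_transpose, Matrix.mul_assoc]
  have hE : (L.incl s r)ᵀ * L.incl s r = 1 := by
    have := L.Q_transpose_mul_self s
    rwa [← L.Q_mul_incl s r, Matrix.transpose_mul, Matrix.mul_assoc,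
      ← Matrix.mul_assoc _ (L.Q (s + r)), L.Q_transpose_mul_self, Matrix.one_mul] at this
  -- By Lanczos exactness p contributes equally to both compressions, so f may be replaced by f - p
  -- in each of them.
  have hX : L.X f s r - (L.Q s)ᵀ * cfc f A * L.Q s =
      (Wᵀ * L.incl s r)ᵀ * diagonal (fun j => f (μ j) - p.eval (μ j)) * (Wᵀ * L.incl s r) +
        -((Uᵀ * L.Q s)ᵀ * diagonal (fun i => f (lam i) - p.eval (lam i)) * (Uᵀ * L.Q s)) := by
    have h1 := L.submatrix_aeval_T hA s r hp
    rw [haeval, L.submatrix_idxIncl, hT, aeval_conj_diagonal hW] at h1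
    rw [BlockLanczosRun.X, L.submatrix_idxIncl, hT, cfc_conj_diagonal hW, hcfc,
      ← Matrix.diagonal_sub, ← Matrix.diagonal_sub]
    simp only [Matrix.transpose_mul, Matrix.transpose_transpose, Matrix.mul_sub, Matrix.sub_mul]
    simp only [Matrix.mul_assoc] at h1 ⊢
    rw [h1]
    abel
  rw [hX, two_mul]
  refine (frobNorm_add_le _ _).trans (add_le_add ?_ ?_)
  · refine frobNorm_conj_diagonal_le ?_ fun j => hε _ (hμ j)
    rw [Matrix.transpose_mul, Matrix.transpose_transpose, Matrix.mul_assoc, ← Matrix.mul_assoc W,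
      hW', Matrix.one_mul, hE]
  · rw [frobNorm_neg]
    refine frobNorm_conj_diagonal_le ?_ fun j => hε _ (hlam j)
    rw [Matrix.transpose_mul, Matrix.transpose_transpose, Matrix.mul_assoc, ← Matrix.mul_assoc U,
      hU', Matrix.one_mul, L.Q_transpose_mul_self]

/-- Truncating a perturbed compression. -/
theorem frobNorm_sub_truncation_le {m ι : Type*} [Fintype m] [DecidableEq m] [Fintype ι]
    [DecidableEq ι] {Q : Matrix m ι ℝ} (hQ : Qᵀ * Q = 1) (M : Matrix m m ℝ) {X Xk C : Matrix ι ι ℝ}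
    {k : ℕ} (hX : IsTruncatedSVD X k Xk) {P : Matrix ι ι ℝ} (hT : Pᵀ = P) (hP : P * P = P)
    (htr : P.trace ≤ k) (hC : P * C = C) :
    frobNorm (M - Q * Xk * Qᵀ) ≤
      2 * frobNorm (X - Qᵀ * M * Q) + frobNorm (M - Q * C * Qᵀ) := by
  set Y := Qᵀ * M * Q with hY
  set e := frobNorm (X - Y)
  have h0 : 0 ≤ e := frobNorm_nonneg _
  have h1 : frobNorm (Y - Xk) ≤ 2 * e + frobNorm (Y - C) := by
    have h2 : frobNorm (Y - Xk) ≤ e + frobNorm (X - Xk) := by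
      rw [show Y - Xk = -(X - Y) + (X - Xk) by abel]
      exact (frobNorm_add_le _ _).trans_eq (by rw [frobNorm_neg])
    have h3 : frobNorm (X - C) ≤ e + frobNorm (Y - C) := by
      rw [show X - C = (X - Y) + (Y - C) by abel]
      exact frobNorm_add_le _ _
    linarith [hX.frobNorm_sub_le hT hP htr hC]
  have h4 := frobNorm_sub_conj_sq hQ M Xk
  have h5 := frobNorm_sub_conj_sq hQ M C
  rw [← hY] at h4 h5
  have hle : frobNorm (Y - C) ≤ frobNorm (M - Q * C * Qᵀ) := frobNorm_le_of_sq_le (by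
    exact h5 ▸ le_add_of_nonneg_left (sq_nonneg _))
  -- With ρ the distance from M to its compression and c = ‖Y - C‖, this is ρ² + (2e + c)² ≤ (2e +
  -- √(ρ² + c²))²; the cross term needs only c ≤ √(ρ² + c²).
  refine (pow_le_pow_iff_left₀ (frobNorm_nonneg _)
    (add_nonneg (by positivity) (frobNorm_nonneg _)) two_ne_zero).1 ?_
  have h6 := pow_le_pow_left₀ (frobNorm_nonneg _) h1 2
  nlinarith [mul_le_mul_of_nonneg_left hle h0]

/-- The deterministic error bound, in terms of Krylov vectors with prescribed leading
coordinates. -/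
theorem frobNorm_sub_krylovAware_le {A U : Matrix (Fin n) (Fin n) ℝ} {lam : Fin n → ℝ}
    (hU : Uᵀ * U = 1) (hA : A = U * diagonal lam * Uᵀ) {f : ℝ → ℝ}
    (hlam : Antitone fun i => |f (lam i)|) {k s r : ℕ} (hkn : k ≤ n) {w : Fin n → ℝ}
    {q : Fin n → Polynomial ℝ} (hq : ∀ j, (q j).natDegree < k + s)
    (hq0 : ∀ j : Fin n, k ≤ (j : ℕ) → q j = 0)
    (hq1 : ∀ i j : Fin n, (i : ℕ) < k → (j : ℕ) < k →
      (Uᵀ *ᵥ w) i * (q j).eval (lam i) = if i = j then 1 else 0)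
    {B : Matrix (Fin n) (Fin n) ℝ} (hB : IsSingleVectorKrylovAware A f k s r w B)
    {p : Polynomial ℝ} (hp : p.natDegree < 2 * r + 2) {ε : ℝ}
    (hε : ∀ x ∈ Set.Icc (⨅ i, lam i) (⨆ i, lam i), |f x - p.eval x| ≤ ε) :
    frobNorm (cfc f A - B) ≤ 4 * √((k : ℝ) + s) * |ε| +
      √((∑ i : Fin n, if k ≤ (i : ℕ) then f (lam i) ^ 2 else 0) +
        4 * ∑ i : Fin n, ∑ j : Fin n, if k ≤ (i : ℕ) ∧ (j : ℕ) < k then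
          ((Uᵀ *ᵥ w) i * (q j).eval (lam i) * f (lam j)) ^ 2 else 0) := by
  obtain ⟨L, Xk, hX, rfl⟩ := hB
  have hU' : U * Uᵀ = 1 := mul_eq_one_comm.1 hU
  set g := Uᵀ *ᵥ w with hg
  -- Column j holds the eigenbasis coordinates of the Krylov vector q_j(A) w.
  set Z : Matrix (Fin n) (Fin n) ℝ := Matrix.of fun i j => g i * (q j).eval (lam i) with hZ
  set J : Matrix (Fin n) (Fin n) ℝ := diagonal fun i => if (i : ℕ) < k then 1 else 0 with hJ
  have hZ0 : ∀ i j : Fin n, k ≤ (j : ℕ) → Z i j = 0 := by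
    intro i j hj; simp [hZ, hq0 j hj]
  obtain ⟨P, hPT, hPP, hPZ, hZP, hPtr, Bz, hBz⟩ := exists_proj_of_oblique (J := J) (Z := Z)
    (Matrix.diagonal_transpose _) (by rw [hJ, Matrix.diagonal_mul_diagonal]; simp)
    (by
      ext i j
      rw [hJ, Matrix.diagonal_mul, Matrix.diagonal_apply]
      by_cases hi : (i : ℕ) < k
      · by_cases hj : (j : ℕ) < k
        · simp [hi, hZ, hq1 i j hi hj]
        · have : i ≠ j := fun h => hj (h ▸ hi)
          simp [hZ0 i j (not_lt.1 hj), this]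
      · simp [hi])
    (by
      ext i j
      rw [hJ, Matrix.mul_diagonal]
      by_cases hj : (j : ℕ) < k
      · simp [hj]
      · simp [hj, hZ0 i j (not_lt.1 hj)])
  have htr : P.trace = k := by
    rw [hPtr, hJ, Matrix.trace_diagonal, Finset.sum_ite]
    simp only [Finset.sum_const_zero, add_zero, Finset.sum_const, nsmul_eq_mul, mul_one]
    rw [Fin.card_filter_val_lt, min_eq_right hkn]
  set Q := L.Q (k + s) with hQdef
  have hQ : Qᵀ * Q = 1 := L.Q_transpose_mul_self _
  have hQZ : Q * (Qᵀ * (U * Z)) = U * Z := by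
    ext x j
    have h1 := L.proj_mul_aeval_mul (hq j)
    have haeval : Polynomial.aeval A (q j) =
        U * diagonal (fun i => (q j).eval (lam i)) * Uᵀ := by
      rw [hA, aeval_conj_diagonal hU]
    have h2 : ∀ x, (Polynomial.aeval A (q j) *
        Matrix.replicateCol (Fin 1) w) x 0 = (U * Z) x j := by
      intro x
      rw [haeval, Matrix.mul_assoc, Matrix.mul_assoc, Matrix.mul_apply,
        Matrix.mul_apply]
      refine Finset.sum_congr rfl fun i _ => ?_
      rw [Matrix.diagonal_mul, hZ, Matrix.of_apply, mul_comm (g i)]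
      rfl
    have h3 := congrFun (congrFun h1 x) 0
    rw [h2] at h3
    rw [← h3, Matrix.mul_apply, Matrix.mul_apply]
    refine Finset.sum_congr rfl fun y _ => ?_
    rw [Matrix.mul_apply, Matrix.mul_apply]
    congr 1
    exact Finset.sum_congr rfl fun z _ => by rw [h2]
  have hQP : Q * (Qᵀ * (U * P)) = U * P := by
    rw [hBz, ← Matrix.mul_assoc U, ← Matrix.mul_assoc Qᵀ, ← Matrix.mul_assoc Q, hQZ]
  have hPQ : P * (Uᵀ * (Q * Qᵀ)) = P * Uᵀ := by
    have := congrArg Matrix.transpose hQP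
    simpa [Matrix.transpose_mul, hPT, Matrix.mul_assoc] using this
  set d : Fin n → ℝ := fun i => f (lam i) with hd
  -- The competitor is P f(Λ) P written in the coordinates of Q. Nothing is lost, since the range of
  -- U P lies in that of Q.
  have hmain := frobNorm_sub_truncation_le hQ (cfc f A) hX
    (P := Qᵀ * (U * P) * (Qᵀ * (U * P))ᵀ) (C := Qᵀ * (U * P) * diagonal d * (Qᵀ * (U * P))ᵀ)
    ?_ ?_ ?_ ?_
  rotate_left
  · simp [Matrix.transpose_mul, Matrix.mul_assoc]
  all_goals
    have hR : (Qᵀ * (U * P))ᵀ * (Qᵀ * (U * P)) = P := by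
      rw [Matrix.transpose_mul, Matrix.transpose_transpose, Matrix.mul_assoc, hQP,
        Matrix.transpose_mul, hPT, Matrix.mul_assoc, ← Matrix.mul_assoc Uᵀ, hU, Matrix.one_mul, hPP]
    have hRP : Qᵀ * (U * P) * P = Qᵀ * (U * P) := by
      rw [Matrix.mul_assoc, Matrix.mul_assoc, hPP]
  · rw [← Matrix.mul_assoc, Matrix.mul_assoc (Qᵀ * (U * P)), hR, hRP]
  · rw [Matrix.trace_mul_comm, hR, htr]
  · rw [← Matrix.mul_assoc, ← Matrix.mul_assoc, Matrix.mul_assoc (Qᵀ * (U * P)) _ (Qᵀ * (U * P)),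
      hR, hRP]
  refine hmain.trans (add_le_add ?_ ?_)
  · have h1 := L.frobNorm_X_sub_le hU hA f (k + s) r hp (fun i =>
      ⟨ciInf_le (Set.finite_range lam).bddBelow i, le_ciSup (Set.finite_range lam).bddAbove i⟩) hε
    have h2 : √(Fintype.card (L.Idx (k + s))) ≤ √((k : ℝ) + s) := by
      apply Real.sqrt_le_sqrt
      have := L.card_Idx_le (k + s)
      rw [mul_one] at this
      exact_mod_cast this
    nlinarith [mul_le_mul_of_nonneg_right h2 (abs_nonneg ε)]
  · apply Real.le_sqrt_of_sq_le
    have hcfc : cfc f A = U * diagonal d * Uᵀ := by rw [hA, cfc_conj_diagonal hU]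
    have h1 : cfc f A -
        Q * (Qᵀ * (U * P) * diagonal d * (Qᵀ * (U * P))ᵀ) * Qᵀ =
        U * (diagonal d - P * diagonal d * P) * Uᵀ := by
      rw [hcfc, Matrix.mul_sub, Matrix.sub_mul]
      congr 1
      rw [← Matrix.mul_assoc, ← Matrix.mul_assoc, hQP, Matrix.transpose_mul,
        Matrix.transpose_transpose, Matrix.transpose_mul, hPT]
      simp only [Matrix.mul_assoc]
      rw [hPQ]
    rw [h1, frobNorm_mul_transpose_of_transpose_mul_self hU, frobNorm_mul_of_transpose_mul_self hU]
    exact frobNorm_diagonal_sub_proj_sq_le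
      (fun i j hj hi => hlam (by rw [Fin.le_def]; omega)) hq1 hZ0 hPT hPP hPZ hZP

end Combination

/-! ### Eigenvalue gaps and Krylov polynomials -/

section Gap

variable {n k : ℕ} {lam : Fin n → ℝ}

theorem gammaMin_nonneg : 0 ≤ gammaMin lam k := Real.iInf_nonneg fun _ => by positivity

theorem abs_sub_le_spread (i j : Fin n) : |lam i - lam j| ≤ |(⨆ i, lam i) - ⨅ i, lam i| := by
  have h1 : ∀ i, lam i ≤ ⨆ i, lam i := le_ciSup (Set.finite_range lam).bddAbove
  have h2 : ∀ i, ⨅ i, lam i ≤ lam i := ciInf_le (Set.finite_range lam).bddBelow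
  rw [abs_le]
  have h3 := le_abs_self ((⨆ i, lam i) - ⨅ i, lam i)
  constructor <;> linarith [h1 i, h2 i, h1 j, h2 j]

theorem gammaMin_le {i j : Fin n} (hi : (i : ℕ) < k) (hj : (j : ℕ) < k) (hij : i ≠ j) :
    gammaMin lam k ≤ |lam j - lam i| / |(⨆ i, lam i) - ⨅ i, lam i| :=
  ciInf_le (f := fun q : {q : Fin n × Fin n // (q.1 : ℕ) < k ∧ (q.2 : ℕ) < k ∧ q.1 ≠ q.2} =>
      |lam q.1.2 - lam q.1.1| / |(⨆ i, lam i) - ⨅ i, lam i|)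
    (Set.finite_range _).bddBelow ⟨(i, j), hi, hj, hij⟩

theorem gammaMin_pos_of_ne (hγ : 2 ≤ k → gammaMin lam k ≠ 0) {i j : Fin n} (hi : (i : ℕ) < k)
    (hj : (j : ℕ) < k) (hij : i ≠ j) : 0 < gammaMin lam k := by
  refine lt_of_le_of_ne gammaMin_nonneg (hγ ?_).symm
  have : (i : ℕ) ≠ j := fun h => hij (Fin.ext h)
  omega

theorem injOn_of_gammaMin_ne_zero (hγ : 2 ≤ k → gammaMin lam k ≠ 0) :
    Set.InjOn lam (Finset.univ.filter fun i : Fin n => (i : ℕ) < k) := by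
  intro i hi j hj h
  simp only [Finset.coe_filter, Finset.mem_univ, true_and, Set.mem_ofPred_eq] at hi hj
  by_contra hij
  have h1 := gammaMin_le (lam := lam) hi hj hij
  rw [h, sub_self, abs_zero, zero_div] at h1
  exact absurd (gammaMin_pos_of_ne hγ hi hj hij) (not_lt.2 h1)

/-- The Lagrange basis polynomials of the leading eigenvalues are bounded on the spectrum. -/
theorem sq_eval_basis_le (hγ : 2 ≤ k → gammaMin lam k ≠ 0) (hkn : k ≤ n) {j : Fin n}
    (hj : (j : ℕ) < k) (i : Fin n) :
    (Lagrange.basis (Finset.univ.filter fun i : Fin n => (i : ℕ) < k) lam j).eval (lam i) ^ 2 ≤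
      1 / gammaMin lam k ^ (2 * (k - 1)) := by
  have h1 : |(Lagrange.basis (Finset.univ.filter fun i : Fin n => (i : ℕ) < k) lam j).eval
      (lam i)| ≤ (1 / gammaMin lam k) ^ (k - 1) := by
    have hcard : ((Finset.univ.filter fun i : Fin n => (i : ℕ) < k).erase j).card = k - 1 := by
      rw [Finset.card_erase_of_mem (by simpa using hj), Fin.card_filter_val_lt, min_eq_right hkn]
    rw [Lagrange.basis, Polynomial.eval_prod, Finset.abs_prod, ← hcard, ← Finset.prod_const]
    -- Each of the k - 1 factors |λ_i - λ_m| / |λ_j - λ_m| is at most spread over gap, hence at most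
    -- 1/γ.
    refine Finset.prod_le_prod (fun _ _ => abs_nonneg _) fun m hm => ?_
    simp only [Finset.mem_erase, Finset.mem_filter, Finset.mem_univ, true_and] at hm
    have hpos := gammaMin_pos_of_ne hγ hm.2 hj hm.1
    have hle := gammaMin_le (lam := lam) hm.2 hj hm.1
    have hquot := hpos.trans_le hle
    have hΔ : 0 < |(⨆ i, lam i) - ⨅ i, lam i| := by
      refine lt_of_le_of_ne (abs_nonneg _) fun h => ?_
      rw [← h, div_zero] at hquot
      exact lt_irrefl _ hquot
    have hd : 0 < |lam j - lam m| := by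
      refine lt_of_le_of_ne (abs_nonneg _) fun h => ?_
      rw [← h, zero_div] at hquot
      exact lt_irrefl _ hquot
    rw [le_div_iff₀ hΔ] at hle
    simp only [Lagrange.basisDivisor, Polynomial.eval_mul, Polynomial.eval_C, Polynomial.eval_sub,
      Polynomial.eval_X, abs_mul, abs_inv]
    rw [inv_mul_le_iff₀ hd, mul_one_div, le_div_iff₀ hpos]
    nlinarith [abs_sub_le_spread (lam := lam) i m]
  rw [← sq_abs]
  refine (pow_le_pow_left₀ (abs_nonneg _) h1 2).trans_eq ?_
  rw [← pow_mul, mul_comm (k - 1), _root_.one_div_pow]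

/-- Take q_j = p ℓ_j / (g_j p(λ_j)): ℓ_j interpolates at the leading eigenvalues, while p damps the
tail. The factor 1/t² bounds 1/g_j², the gap power bounds ℓ_j², and k counts the columns. -/
theorem exists_krylov_polynomials (hγ : 2 ≤ k → gammaMin lam k ≠ 0) (hkn : k ≤ n) {s : ℕ}
    (f : ℝ → ℝ) {p : Polynomial ℝ} (hp : p.natDegree < s)
    (hp0 : ∀ i : Fin n, (i : ℕ) < k → p.eval (lam i) ≠ 0) {g : Fin n → ℝ} {t : ℝ} (ht : 0 < t)
    (hg : ∀ i : Fin n, (i : ℕ) < k → t ≤ |g i|) :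
    ∃ q : Fin n → Polynomial ℝ, (∀ j, (q j).natDegree < k + s) ∧
      (∀ j : Fin n, k ≤ (j : ℕ) → q j = 0) ∧
      (∀ i j : Fin n, (i : ℕ) < k → (j : ℕ) < k →
        g i * (q j).eval (lam i) = if i = j then 1 else 0) ∧
      (∑ i : Fin n, ∑ j : Fin n, if k ≤ (i : ℕ) ∧ (j : ℕ) < k then
          (g i * (q j).eval (lam i) * f (lam j)) ^ 2 else 0) ≤
        k / t ^ 2 * (1 / gammaMin lam k ^ (2 * (k - 1))) *
          ((∑ i : Fin n, if k ≤ (i : ℕ) then p.eval (lam i) ^ 2 * g i ^ 2 else 0) *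
            ⨆ i : {i : Fin n // (i : ℕ) < k}, |f (lam i) / p.eval (lam i)| ^ 2) := by
  set S := Finset.univ.filter fun i : Fin n => (i : ℕ) < k with hS
  have hmem : ∀ i : Fin n, i ∈ S ↔ (i : ℕ) < k := by simp [hS]
  have hcardS : S.card = k := by rw [hS, Fin.card_filter_val_lt, min_eq_right hkn]
  have hinj : Set.InjOn lam S := injOn_of_gammaMin_ne_zero hγ
  have hg0 : ∀ i : Fin n, (i : ℕ) < k → g i ≠ 0 := fun i hi h => by
    have := hg i hi; rw [h, abs_zero] at this; linarith
  set c := ⨆ i : {i : Fin n // (i : ℕ) < k}, |f (lam i) / p.eval (lam i)| ^ 2 with hc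
  have hc0 : 0 ≤ c := Real.iSup_nonneg fun _ => sq_nonneg _
  have hcle : ∀ j : Fin n, (j : ℕ) < k → (f (lam j) / p.eval (lam j)) ^ 2 ≤ c := by
    intro j hj
    rw [← sq_abs]
    exact le_ciSup (f := fun i : {i : Fin n // (i : ℕ) < k} =>
      |f (lam i) / p.eval (lam i)| ^ 2) (Set.finite_range _).bddAbove ⟨j, hj⟩
  refine ⟨fun j => if (j : ℕ) < k then
    Polynomial.C (g j * p.eval (lam j))⁻¹ * (p * Lagrange.basis S lam j) else 0, ?_, ?_, ?_, ?_⟩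
  · intro j
    dsimp only
    split_ifs with hj
    · have h1 := Polynomial.natDegree_C_mul_le (g j * p.eval (lam j))⁻¹ (p * Lagrange.basis S lam j)
      have h2 := Polynomial.natDegree_mul_le (p := p) (q := Lagrange.basis S lam j)
      rw [Lagrange.natDegree_basis hinj ((hmem j).2 hj), hcardS] at h2
      omega
    · rw [Polynomial.natDegree_zero]; omega
  · intro j hj
    simp [not_lt.2 hj]
  · intro i j hi hj
    simp only [hj, if_true, Polynomial.eval_mul, Polynomial.eval_C]
    by_cases hij : i = j
    · subst hij
      rw [Lagrange.eval_basis_self hinj ((hmem i).2 hi), if_pos rfl]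
      have := hg0 i hi
      have := hp0 i hi
      field_simp
    · rw [Lagrange.eval_basis_of_ne (Ne.symm hij) ((hmem i).2 hi), if_neg hij]
      ring
  · have hterm : ∀ i j : Fin n, (if k ≤ (i : ℕ) ∧ (j : ℕ) < k then
        (g i * (if (j : ℕ) < k then Polynomial.C (g j * p.eval (lam j))⁻¹ *
          (p * Lagrange.basis S lam j) else 0 : Polynomial ℝ).eval (lam i) * f (lam j)) ^ 2 else 0) ≤
        (if k ≤ (i : ℕ) then p.eval (lam i) ^ 2 * g i ^ 2 else 0) *
          (if (j : ℕ) < k then 1 / t ^ 2 * (1 / gammaMin lam k ^ (2 * (k - 1))) * c else 0) := by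
      intro i j
      by_cases hi : k ≤ (i : ℕ)
      · by_cases hj : (j : ℕ) < k
        · simp only [hi, hj, and_self, if_true, Polynomial.eval_mul, Polynomial.eval_C]
          have e : (g i * ((g j * p.eval (lam j))⁻¹ *
              (p.eval (lam i) * (Lagrange.basis S lam j).eval (lam i))) * f (lam j)) ^ 2 =
              p.eval (lam i) ^ 2 * g i ^ 2 * ((1 / g j ^ 2) *
                (Lagrange.basis S lam j).eval (lam i) ^ 2 * (f (lam j) / p.eval (lam j)) ^ 2) := by
            have := hg0 j hj
            have := hp0 j hj
            field_simp
          rw [e]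
          have h1 : 1 / g j ^ 2 ≤ 1 / t ^ 2 := by
            rw [← sq_abs (g j)]
            exact one_div_le_one_div_of_le (by positivity)
              (pow_le_pow_left₀ ht.le (hg j hj) 2)
          have h2 := sq_eval_basis_le hγ hkn hj i
          have h3 := hcle j hj
          have h4 : 0 ≤ 1 / gammaMin lam k ^ (2 * (k - 1)) := le_trans (sq_nonneg _) h2
          refine mul_le_mul_of_nonneg_left ?_ (by positivity)
          exact mul_le_mul (mul_le_mul h1 h2 (sq_nonneg _) (by positivity)) h3 (sq_nonneg _)
            (mul_nonneg (by positivity) h4)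
        · simp [hj]
      · simp [hi]
    refine (Finset.sum_le_sum fun i _ => Finset.sum_le_sum fun j _ => hterm i j).trans_eq ?_
    simp only [← Finset.mul_sum]
    rw [← Finset.sum_mul, ← Finset.sum_filter (fun j : Fin n => (j : ℕ) < k), ← hS,
      Finset.sum_const, hcardS, nsmul_eq_mul]
    ring

end Gap

/-! ### Passing to the best uniform approximation -/

section Deterministic

theorem frobNorm_tailDiag_sq {n : ℕ} (lam : Fin n → ℝ) (k : ℕ) (g : ℝ → ℝ) :
    frobNorm (tailDiag lam k g) ^ 2 = ∑ i : Fin n, if k ≤ (i : ℕ) then g (lam i) ^ 2 else 0 := by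
  rw [frobNorm_sq, ← Finset.sum_filter,
    Finset.sum_subtype (Finset.univ.filter fun i : Fin n => k ≤ (i : ℕ)) (p := fun i : Fin n => k ≤ (i : ℕ))
      (by simp)]
  refine Finset.sum_congr rfl fun i _ => ?_
  rw [Finset.sum_eq_single i (fun j _ hj => by simp [tailDiag, hj.symm]) (by simp)]
  simp [tailDiag]

/-- The error bound on the event that the leading coordinates of the starting vector are not too
small. -/
theorem ofReal_frobNorm_sub_krylovAware_le {n : ℕ} {A U : Matrix (Fin n) (Fin n) ℝ}
    {lam : Fin n → ℝ} (hU : Uᵀ * U = 1) (hA : A = U * diagonal lam * Uᵀ) {f : ℝ → ℝ}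
    (hlam : Antitone fun i => |f (lam i)|) {k s r : ℕ} (hk : 1 ≤ k) (hkn : k ≤ n)
    (hγ : 2 ≤ k → gammaMin lam k ≠ 0) {p : Polynomial ℝ} (hp : p.natDegree < s)
    (hp0 : ∀ i : Fin n, (i : ℕ) < k → p.eval (lam i) ≠ 0) {w : Fin n → ℝ} {t : ℝ} (ht : 0 < t)
    (hw : ∀ i : Fin n, (i : ℕ) < k → t ≤ |(Uᵀ *ᵥ w) i|) {B : Matrix (Fin n) (Fin n) ℝ}
    (hB : IsSingleVectorKrylovAware A f k s r w B) :
    ENNReal.ofReal (frobNorm (cfc f A - B)) ≤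
      ENNReal.ofReal (4 * √((k : ℝ) + s)) *
          polyApproxError f (2 * r + 1) (⨅ i, lam i) (⨆ i, lam i) +
        ENNReal.ofReal (√(frobNorm (tailDiag lam k f) ^ 2 +
          4 * (k / t ^ 2 * (1 / gammaMin lam k ^ (2 * (k - 1))) *
          ((∑ i : Fin n, if k ≤ (i : ℕ) then p.eval (lam i) ^ 2 * (Uᵀ *ᵥ w) i ^ 2 else 0) *
            ⨆ i : {i : Fin n // (i : ℕ) < k}, |f (lam i) / p.eval (lam i)| ^ 2)))) := by
  obtain ⟨q, hq, hq0, hq1, hq2⟩ := exists_krylov_polynomials hγ hkn f hp hp0 ht hw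
  have hcoef : 0 < 4 * √((k : ℝ) + s) := by
    have : (0 : ℝ) < k := by exact_mod_cast hk
    positivity
  have hcoef' : ENNReal.ofReal (4 * √((k : ℝ) + s)) ≠ 0 := by simpa using hcoef
  -- It suffices to treat one polynomial at a time. Those of too large degree, or with infinite
  -- uniform error, make the right side infinite.
  rw [polyApproxError, ENNReal.mul_iInf_of_ne hcoef' ENNReal.ofReal_ne_top, ENNReal.iInf_add]
  refine le_iInf fun P => ?_
  by_cases hP : P ∈ Polynomial.degreeLE ℝ ((2 * r + 1 : ℕ) : WithBot ℕ)
  swap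
  · rw [iInf_neg hP, ENNReal.mul_top hcoef', top_add]
    exact le_top
  rw [iInf_pos hP]
  set e := ⨆ x ∈ Set.Icc (⨅ i, lam i) (⨆ i, lam i), ‖f x - P.eval x‖ₑ with he
  by_cases htop : e = ⊤
  · rw [htop, ENNReal.mul_top hcoef', top_add]
    exact le_top
  have hdeg : P.natDegree < 2 * r + 2 :=
    Nat.lt_succ_of_le (Polynomial.natDegree_le_of_degree_le (Polynomial.mem_degreeLE.1 hP))
  have hε : ∀ x ∈ Set.Icc (⨅ i, lam i) (⨆ i, lam i), |f x - P.eval x| ≤ e.toReal := by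
    intro x hx
    have h1 : ‖f x - P.eval x‖ₑ ≤ e := by
      rw [he]; exact le_iSup₂ (f := fun x _ => ‖f x - P.eval x‖ₑ) x hx
    have h2 := ENNReal.toReal_mono htop h1
    rwa [toReal_enorm, Real.norm_eq_abs] at h2
  have hmain := frobNorm_sub_krylovAware_le hU hA hlam hkn hq hq0 hq1 hB hdeg hε
  have h3 : ENNReal.ofReal (4 * √((k : ℝ) + s)) * e =
      ENNReal.ofReal (4 * √((k : ℝ) + s) * |e.toReal|) := by
    rw [ENNReal.ofReal_mul hcoef.le, abs_of_nonneg ENNReal.toReal_nonneg,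
      ENNReal.ofReal_toReal htop]
  rw [h3, ← ENNReal.ofReal_add (by positivity) (Real.sqrt_nonneg _)]
  refine ENNReal.ofReal_le_ofReal (hmain.trans ?_)
  refine add_le_add le_rfl (Real.sqrt_le_sqrt ?_)
  rw [frobNorm_tailDiag_sq]
  linarith

end Deterministic

/-! ### Gaussian tail estimates -/

section Gaussian

theorem gaussianReal_abs_lt_le (t : ℝ) :
    gaussianReal 0 1 {x | |x| < t} ≤ ENNReal.ofReal (2 * t / √(2 * Real.pi)) := by
  rw [gaussianReal_apply _ one_ne_zero]
  have h1 : ∀ x, gaussianPDF 0 1 x ≤ ENNReal.ofReal (1 / √(2 * Real.pi)) := by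
    intro x
    refine ENNReal.ofReal_le_ofReal ?_
    rw [gaussianPDFReal, NNReal.coe_one, mul_one, one_div]
    refine mul_le_of_le_one_right (by positivity) ?_
    rw [Real.exp_le_one_iff]
    have := sq_nonneg (x - 0)
    linarith
  refine (lintegral_mono h1).trans ?_
  rw [setLIntegral_const]
  have h2 : {x : ℝ | |x| < t} = Set.Ioo (-t) t := by ext x; simp [abs_lt]
  rw [h2, Real.volume_Ioo, ← ENNReal.ofReal_mul (by positivity)]
  exact ENNReal.ofReal_le_ofReal (le_of_eq (by ring))

/-- Since -1/2 + 3/8 = -1/8, the integrand times the N(0,1) density is twice the N(0,4) density. -/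
theorem lintegral_exp_sq_gaussianReal :
    ∫⁻ x, ENNReal.ofReal (Real.exp (3 / 8 * x ^ 2)) ∂gaussianReal 0 1 = 2 := by
  rw [gaussianReal_of_var_ne_zero _ one_ne_zero,
    lintegral_withDensity_eq_lintegral_mul _ (measurable_gaussianPDF _ _) (by fun_prop)]
  have h : ∀ x, (gaussianPDF 0 1 * fun x => ENNReal.ofReal (Real.exp (3 / 8 * x ^ 2))) x =
      2 * gaussianPDF 0 4 x := by
    intro x
    rw [Pi.mul_apply, gaussianPDF, gaussianPDF,
      ← ENNReal.ofReal_mul (gaussianPDFReal_nonneg _ _ _),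
      show (2 : ENNReal) = ENNReal.ofReal 2 by simp, ← ENNReal.ofReal_mul (by norm_num)]
    congr 1
    rw [gaussianPDFReal, gaussianPDFReal, NNReal.coe_one, mul_assoc, ← Real.exp_add]
    have h4 : ((4 : NNReal) : ℝ) = 4 := rfl
    rw [h4, Real.sqrt_mul (by positivity) 4, show √(4 : ℝ) = 2 by
      rw [show (4 : ℝ) = 2 ^ 2 by norm_num]; exact Real.sqrt_sq (by norm_num)]
    rw [mul_one, mul_inv]
    have e : -(x - 0) ^ 2 / (2 * 1) + 3 / 8 * x ^ 2 = -(x - 0) ^ 2 / (2 * 4) := by ring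
    rw [e]
    ring
  simp_rw [h]
  rw [lintegral_const_mul _ (measurable_gaussianPDF _ _),
    lintegral_gaussianPDF_eq_one _ (by norm_num), mul_one]

/-- A one-dimensional marginal of a standard Gaussian vector. -/
theorem map_pi_gaussianReal_dotProduct {ι : Type*} [Fintype ι] {u : ι → ℝ} (hu : u ⬝ᵥ u = 1) :
    (Measure.pi fun _ : ι => gaussianReal 0 1).map (fun w => u ⬝ᵥ w) = gaussianReal 0 1 := by
  set a : EuclideanSpace ℝ ι := WithLp.toLp 2 u with ha
  set Λ : StrongDual ℝ (EuclideanSpace ℝ ι) := innerSL ℝ a with hΛ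
  have h1 : (fun w : ι → ℝ => u ⬝ᵥ w) = Λ ∘ (WithLp.toLp 2) := by
    ext w
    simp [hΛ, ha, PiLp.inner_apply, dotProduct, mul_comm]
  have hnorm : ‖Λ‖ ^ 2 = 1 := by
    rw [hΛ, innerSL_apply_norm, EuclideanSpace.real_norm_sq_eq, ← hu]
    simp [ha, dotProduct, pow_two]
  rw [h1, ← Measure.map_map Λ.continuous.measurable (by fun_prop), map_pi_eq_stdGaussian,
    IsGaussian.map_eq_gaussianReal, integral_strongDual_stdGaussian, variance_dual_stdGaussian,
    hnorm, Real.toNNReal_one]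

variable {Ω ι : Type*} [MeasurableSpace Ω] {μ : Measure Ω}

/-- Chernoff bound for weighted sums of squares of (not necessarily independent) standard Gaussian
variables. -/
theorem measure_weighted_sum_sq_gt_le [Fintype ι] {g : ι → Ω → ℝ} (hg : ∀ i, Measurable (g i))
    (hlaw : ∀ i, μ.map (g i) = gaussianReal 0 1) {a : ι → ℝ} (ha : ∀ i, 0 ≤ a i) (c : ℝ) :
    μ {x | c * ∑ i, a i < ∑ i, a i * g i x ^ 2} ≤ ENNReal.ofReal (2 * Real.exp (-(3 / 8 * c))) := by
  rcases (Finset.sum_nonneg fun i (_ : i ∈ Finset.univ) => ha i).eq_or_lt with h0 | hpos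
  · have hz : ∀ i, a i = 0 := fun i =>
      (Finset.sum_eq_zero_iff_of_nonneg fun i _ => ha i).1 h0.symm i (Finset.mem_univ i)
    simp [hz]
  set A := ∑ i, a i with hA
  set b : ι → ℝ := fun i => a i / A with hb
  have hb0 : ∀ i, 0 ≤ b i := fun i => div_nonneg (ha i) hpos.le
  have hb1 : ∑ i, b i = 1 := by rw [← Finset.sum_div, ← hA, div_self hpos.ne']
  set F : Ω → ENNReal := fun x => ∑ i, ENNReal.ofReal (b i) *
    ENNReal.ofReal (Real.exp (3 / 8 * g i x ^ 2)) with hF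
  have hint : ∫⁻ x, F x ∂μ = 2 := by
    rw [hF, lintegral_finsetSum _ (fun i _ => by fun_prop)]
    have : ∀ i, ∫⁻ x, ENNReal.ofReal (b i) * ENNReal.ofReal (Real.exp (3 / 8 * g i x ^ 2)) ∂μ =
        ENNReal.ofReal (b i) * 2 := by
      intro i
      rw [lintegral_const_mul _ (by fun_prop), ← lintegral_exp_sq_gaussianReal, ← hlaw i,
        lintegral_map (by fun_prop) (hg i)]
    simp_rw [this]
    rw [← Finset.sum_mul, ← ENNReal.ofReal_sum_of_nonneg fun i _ => hb0 i, hb1]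
    simp
  have hsub : {x | c * A < ∑ i, a i * g i x ^ 2} ⊆
      {x | ENNReal.ofReal (Real.exp (3 / 8 * c)) ≤ F x} := by
    intro x hx
    simp only [Set.mem_ofPred_eq] at hx ⊢
    have h1 : F x = ENNReal.ofReal (∑ i, b i * Real.exp (3 / 8 * g i x ^ 2)) := by
      rw [ENNReal.ofReal_sum_of_nonneg fun i _ => mul_nonneg (hb0 i) (Real.exp_nonneg _)]
      exact Finset.sum_congr rfl fun i _ => (ENNReal.ofReal_mul (hb0 i)).symm
    rw [h1]
    refine ENNReal.ofReal_le_ofReal ?_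
    -- Jensen's inequality replaces a product of moment generating functions, so independence is not
    -- required.
    have h2 := convexOn_exp.map_sum_le (t := Finset.univ) (w := b)
      (p := fun i => 3 / 8 * g i x ^ 2) (fun i _ => hb0 i) hb1 (fun _ _ => Set.mem_univ _)
    simp only [smul_eq_mul] at h2
    refine le_trans (Real.exp_le_exp.2 ?_) h2
    have h3 : ∑ i, b i * (3 / 8 * g i x ^ 2) = 3 / 8 * ((∑ i, a i * g i x ^ 2) / A) := by
      rw [Finset.sum_div, Finset.mul_sum]
      refine Finset.sum_congr rfl fun i _ => ?_
      simp only [hb]; ring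
    rw [h3]
    have : c ≤ (∑ i, a i * g i x ^ 2) / A := by rw [le_div_iff₀ hpos]; exact hx.le
    linarith
  refine (measure_mono hsub).trans ?_
  refine (meas_ge_le_lintegral_div (by fun_prop) (by simpa using Real.exp_pos _)
    ENNReal.ofReal_ne_top).trans ?_
  rw [hint, show (2 : ENNReal) = ENNReal.ofReal 2 by simp, ← ENNReal.ofReal_div_of_pos (by positivity),
    Real.exp_neg, div_eq_mul_inv]

/-- With t = log(2/δ) the exponent is -2t - (3/8 + t/4). The first part gives (δ/2)² ≤ δ/4; the
second gives at most 2/3, because t ≥ 1/2 and exp x ≥ 1 + x. -/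
theorem two_mul_exp_le {δ : ℝ} (h0 : 0 < δ) (h1 : δ < 1) :
    2 * Real.exp (-(3 / 8 * (1 + 6 * Real.log (2 / δ)))) ≤ δ / 3 := by
  set t := Real.log (2 / δ) with ht
  have ht' : Real.exp (-t) = δ / 2 := by
    rw [ht, Real.exp_neg, Real.exp_log (by positivity), inv_div]
  have ht1 : 1 / 2 ≤ t := by
    have h2 : Real.log 2 ≤ t := Real.log_le_log (by norm_num) (by rw [le_div_iff₀ h0]; linarith)
    have := Real.log_two_gt_d9
    linarith
  have e : Real.exp (-(3 / 8 * (1 + 6 * t))) = Real.exp (-(3 / 8 + t / 4)) * (δ / 2) ^ 2 := by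
    rw [← ht', ← Real.exp_nat_mul, ← Real.exp_add]
    congr 1; push_cast; ring
  have h2 : Real.exp (-(3 / 8 + t / 4)) ≤ 2 / 3 := by
    rw [Real.exp_neg, inv_le_comm₀ (Real.exp_pos _) (by norm_num)]
    have := Real.add_one_le_exp (3 / 8 + t / 4)
    linarith
  rw [e]
  have h3 : (δ / 2) ^ 2 ≤ δ / 4 := by nlinarith
  have := mul_le_mul h2 h3 (sq_nonneg _) (by norm_num)
  linarith

end Gaussian

/-! ### Probability of a good starting vector -/

section Event

variable {n : ℕ}

theorem row_dotProduct_self {U : Matrix (Fin n) (Fin n) ℝ} (hU : Uᵀ * U = 1) (i : Fin n) :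
    Uᵀ i ⬝ᵥ Uᵀ i = 1 := by
  have := congrFun (congrFun hU i) i
  rwa [Matrix.one_apply_eq] at this

/-- The event on which the starting vector is good for the polynomial `p`. -/
def goodStart (U : Matrix (Fin n) (Fin n) ℝ) (lam : Fin n → ℝ) (k : ℕ) (δ : ℝ)
    (p : Polynomial ℝ) : Set (Fin n → ℝ) :=
  {w | (∀ i : Fin n, (i : ℕ) < k → δ * √(2 / Real.pi) / k ≤ |(Uᵀ *ᵥ w) i|) ∧
    (∑ i : Fin n, if k ≤ (i : ℕ) then p.eval (lam i) ^ 2 * (Uᵀ *ᵥ w) i ^ 2 else 0) ≤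
      (1 + 6 * Real.log (2 / δ)) * frobNorm (tailDiag lam k fun x => p.eval x) ^ 2}

theorem measurable_mulVec_apply (M : Matrix (Fin n) (Fin n) ℝ) (i : Fin n) :
    Measurable fun w => (M *ᵥ w) i := by
  unfold Matrix.mulVec dotProduct
  fun_prop

theorem measurableSet_goodStart (U : Matrix (Fin n) (Fin n) ℝ) (lam : Fin n → ℝ) (k : ℕ) (δ : ℝ)
    (p : Polynomial ℝ) : MeasurableSet (goodStart U lam k δ p) := by
  have hm := measurable_mulVec_apply Uᵀ
  have h1 : MeasurableSet {w : Fin n → ℝ |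
      ∀ i : Fin n, (i : ℕ) < k → δ * √(2 / Real.pi) / k ≤ |(Uᵀ *ᵥ w) i|} := by
    simp only [Set.ofPred_forall]
    exact MeasurableSet.iInter fun i => MeasurableSet.iInter fun _ =>
      measurableSet_le measurable_const (hm i).abs
  refine h1.inter (measurableSet_le (f := fun w : Fin n → ℝ => ∑ i : Fin n,
    if k ≤ (i : ℕ) then p.eval (lam i) ^ 2 * (Uᵀ *ᵥ w) i ^ 2 else 0)
    (Finset.measurable_sum _ fun i _ => ?_) measurable_const)
  split_ifs
  · exact ((hm i).pow_const 2).const_mul _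
  · exact measurable_const

/-- A union bound: the k leading coordinates fail with total probability at most 2δ/π, the tail sum
with at most δ/3, and 2/π + 1/3 ≤ 1 because π > 3. -/
theorem measure_compl_goodStart_le {U : Matrix (Fin n) (Fin n) ℝ} (hU : Uᵀ * U = 1)
    (lam : Fin n → ℝ) {k : ℕ} (hk : 1 ≤ k) (hkn : k ≤ n) {δ : ℝ} (h0 : 0 < δ) (h1 : δ < 1)
    (p : Polynomial ℝ) :
    (Measure.pi fun _ : Fin n => gaussianReal 0 1) (goodStart U lam k δ p)ᶜ ≤
      ENNReal.ofReal δ := by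
  set μ : Measure (Fin n → ℝ) := Measure.pi fun _ : Fin n => gaussianReal 0 1 with hμ
  have hk' : (0 : ℝ) < k := by exact_mod_cast hk
  have hm := measurable_mulVec_apply Uᵀ
  have hlaw : ∀ i, μ.map (fun w => (Uᵀ *ᵥ w) i) = gaussianReal 0 1 := fun i =>
    map_pi_gaussianReal_dotProduct (row_dotProduct_self hU i)
  set t := δ * √(2 / Real.pi) / k with ht
  set S := Finset.univ.filter fun i : Fin n => (i : ℕ) < k with hS
  set E := {w : Fin n → ℝ | (1 + 6 * Real.log (2 / δ)) *
    ∑ i : Fin n, (if k ≤ (i : ℕ) then p.eval (lam i) ^ 2 else 0) <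
      ∑ i : Fin n, (if k ≤ (i : ℕ) then p.eval (lam i) ^ 2 else 0) * (Uᵀ *ᵥ w) i ^ 2} with hE
  have hsub : (goodStart U lam k δ p)ᶜ ⊆ (⋃ i ∈ S, {w | |(Uᵀ *ᵥ w) i| < t}) ∪ E := by
    intro w hw
    by_contra hcon
    simp only [Set.mem_union, Set.mem_iUnion, Set.mem_ofPred_eq, not_or, not_exists, not_lt, hE, hS,
      Finset.mem_filter, Finset.mem_univ, true_and] at hcon
    refine hw ⟨fun i hi => hcon.1 i hi, ?_⟩
    rw [frobNorm_tailDiag_sq]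
    refine le_trans (le_of_eq ?_) hcon.2
    exact Finset.sum_congr rfl fun i _ => by split_ifs <;> simp
  have hE' : μ E ≤ ENNReal.ofReal (δ / 3) := by
    refine (measure_weighted_sum_sq_gt_le (g := fun i w => (Uᵀ *ᵥ w) i) hm hlaw
      (fun i => by split_ifs <;> positivity) _).trans
      (ENNReal.ofReal_le_ofReal (two_mul_exp_le h0 h1))
  have hsmall : ∀ i, μ {w | |(Uᵀ *ᵥ w) i| < t} ≤ ENNReal.ofReal (2 * δ / (Real.pi * k)) := by
    intro i
    have h2 := gaussianReal_abs_lt_le t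
    rw [← hlaw i, Measure.map_apply (hm i)
      (measurableSet_lt (f := fun x : ℝ => |x|) measurable_id.abs measurable_const)] at h2
    refine h2.trans (ENNReal.ofReal_le_ofReal (le_of_eq ?_))
    rw [ht, Real.sqrt_div (by norm_num), Real.sqrt_mul (by norm_num)]
    have h3 : √(2 : ℝ) ≠ 0 := by positivity
    have h4 : √Real.pi ≠ 0 := (Real.sqrt_pos.2 Real.pi_pos).ne'
    have h5 : Real.pi = √Real.pi ^ 2 := (Real.sq_sqrt Real.pi_pos.le).symm
    rw [h5, Real.sqrt_sq (Real.sqrt_nonneg _)]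
    field_simp
  have hcard : S.card = k := by rw [hS, Fin.card_filter_val_lt, min_eq_right hkn]
  calc μ (goodStart U lam k δ p)ᶜ ≤ μ ((⋃ i ∈ S, {w | |(Uᵀ *ᵥ w) i| < t}) ∪ E) := measure_mono hsub
    _ ≤ μ (⋃ i ∈ S, {w | |(Uᵀ *ᵥ w) i| < t}) + μ E := measure_union_le _ _
    _ ≤ (∑ i ∈ S, μ {w | |(Uᵀ *ᵥ w) i| < t}) + μ E :=
      add_le_add (measure_biUnion_finset_le _ _) le_rfl
    _ ≤ (∑ i ∈ S, ENNReal.ofReal (2 * δ / (Real.pi * k))) + ENNReal.ofReal (δ / 3) :=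
      add_le_add (Finset.sum_le_sum fun i _ => hsmall i) hE'
    _ = ENNReal.ofReal (k * (2 * δ / (Real.pi * k)) + δ / 3) := by
      rw [Finset.sum_const, hcard, nsmul_eq_mul, ENNReal.ofReal_add (by positivity) (by positivity),
        ENNReal.ofReal_mul (by positivity), ENNReal.ofReal_natCast]
    _ ≤ ENNReal.ofReal δ := by
      refine ENNReal.ofReal_le_ofReal ?_
      have h6 : k * (2 * δ / (Real.pi * k)) = 2 * δ / Real.pi := by field_simp
      have h7 : 2 * δ / Real.pi ≤ 2 * δ / 3 :=
        div_le_div_of_nonneg_left (by positivity) (by norm_num) Real.pi_gt_three.le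
      rw [h6]
      linarith

end Event

/-! ### Limsup of events -/

section LimsupEvent

/-- If the events `H m` fail with probability at most `a`, then so does the event that infinitely
many of them occur. -/
theorem measure_compl_iInter_iUnion_le {α : Type*} [MeasurableSpace α] {μ : Measure α}
    {H : ℕ → Set α} {a : ENNReal} (h : ∀ m, μ (H m)ᶜ ≤ a) :
    μ (⋂ N, ⋃ m, ⋃ (_ : N ≤ m), H m)ᶜ ≤ a := by
  simp only [Set.compl_iInter, Set.compl_iUnion]
  have hmono : Monotone fun N => ⋂ m, ⋂ (_ : N ≤ m), (H m)ᶜ := by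
    intro N M hNM x hx
    simp only [Set.mem_iInter] at hx ⊢
    exact fun m hm => hx m (hNM.trans hm)
  -- The complement is an increasing union whose N-th member lies in the complement of H N, so
  -- continuity from below applies.
  rw [hmono.measure_iUnion]
  exact iSup_le fun N =>
    (measure_mono (Set.iInter_subset_of_subset N (Set.iInter_subset _ le_rfl))).trans (h N)

end LimsupEvent

/-! ### Assembly of the probabilistic bound -/

/-- The error bound for a starting vector that is good for the polynomial `p`. -/
theorem ofReal_frobNorm_sub_le_of_mem_goodStart {n : ℕ} {A U : Matrix (Fin n) (Fin n) ℝ}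
    {lam : Fin n → ℝ} (hU : Uᵀ * U = 1) (hA : A = U * diagonal lam * Uᵀ) {f : ℝ → ℝ}
    (hlam : Antitone fun i => |f (lam i)|) {k s r : ℕ} {δ : ℝ} (hk : 1 ≤ k) (hkn : k ≤ n)
    (hγ : 2 ≤ k → gammaMin lam k ≠ 0) (hδ0 : 0 < δ) (hδ1 : δ < 1) {p : Polynomial ℝ}
    (hp : p.natDegree < s) (hp0 : ∀ i : Fin n, (i : ℕ) < k → p.eval (lam i) ≠ 0)
    {w : Fin n → ℝ} (hw : w ∈ goodStart U lam k δ p) {B : Matrix (Fin n) (Fin n) ℝ}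
    (hB : IsSingleVectorKrylovAware A f k s r w B) {v : ℝ}
    (hv : frobNorm (tailDiag lam k fun x => p.eval x) ^ 2 *
      (⨆ i : {i : Fin n // (i : ℕ) < k}, |f (lam i) / p.eval (lam i)| ^ 2) ≤ v) :
    ENNReal.ofReal (frobNorm (cfc f A - B)) ≤
      ENNReal.ofReal (4 * √((k : ℝ) + s)) *
          polyApproxError f (2 * r + 1) (⨅ i, lam i) (⨆ i, lam i) +
        ENNReal.ofReal (√(frobNorm (tailDiag lam k f) ^ 2 +
          Chat δ * ((k : ℝ) ^ 4 / gammaMin lam k ^ (2 * (k - 1))) * v)) := by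
  have hk' : (1 : ℝ) ≤ k := by exact_mod_cast hk
  have hπ := Real.pi_pos
  have ht : 0 < δ * √(2 / Real.pi) / k := by positivity
  refine (ofReal_frobNorm_sub_krylovAware_le hU hA hlam hk hkn hγ hp hp0 ht hw.1 hB).trans ?_
  refine add_le_add le_rfl (ENNReal.ofReal_le_ofReal (Real.sqrt_le_sqrt (add_le_add le_rfl ?_)))
  set c := ⨆ i : {i : Fin n // (i : ℕ) < k}, |f (lam i) / p.eval (lam i)| ^ 2
  have hc0 : 0 ≤ c := Real.iSup_nonneg fun _ => sq_nonneg _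
  have hlog : 0 ≤ Real.log (2 / δ) := Real.log_nonneg (by rw [le_div_iff₀ hδ0]; linarith)
  set γ := gammaMin lam k ^ (2 * (k - 1))
  have hγ0 : 0 ≤ γ := pow_nonneg gammaMin_nonneg _
  have ht2 : (δ * √(2 / Real.pi) / k) ^ 2 = δ ^ 2 * (2 / Real.pi) / k ^ 2 := by
    rw [div_pow, mul_pow, Real.sq_sqrt (by positivity)]
  rw [ht2]
  set N := frobNorm (tailDiag lam k fun x => p.eval x) ^ 2
  have hv0 : 0 ≤ v := (mul_nonneg (sq_nonneg _) hc0).trans hv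
  calc _ ≤ 4 * (k / (δ ^ 2 * (2 / Real.pi) / k ^ 2) * (1 / γ) *
        (((1 + 6 * Real.log (2 / δ)) * N) * c)) := by
        have := mul_le_mul_of_nonneg_right hw.2 hc0
        gcongr
    _ = Chat δ * ((k : ℝ) ^ 3 / γ) * (N * c) := by
        rw [Chat]
        field_simp
        ring
    -- The argument yields k³: one k from the columns and k² from 1/t². The fourth power is slack.
    _ ≤ Chat δ * ((k : ℝ) ^ 4 / γ) * v := by
        have hC : 0 ≤ Chat δ := by rw [Chat]; positivity
        have h34 : (k : ℝ) ^ 3 ≤ (k : ℝ) ^ 4 := pow_le_pow_right₀ hk' (by norm_num)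
        have : (k : ℝ) ^ 3 / γ ≤ (k : ℝ) ^ 4 / γ := div_le_div_of_nonneg_right h34 hγ0
        exact mul_le_mul (mul_le_mul_of_nonneg_left this hC) hv
          (mul_nonneg (sq_nonneg _) hc0) (by positivity)

theorem theorem4p1 {n : ℕ} (A U : Matrix (Fin n) (Fin n) ℝ) (lam : Fin n → ℝ) (f : ℝ → ℝ)
    (k s r : ℕ) (δ : ℝ)
    (hU : U ∈ Matrix.orthogonalGroup (Fin n) ℝ)
    (hA : A = U * Matrix.diagonal lam * Uᵀ)
    (hlam : Antitone fun i => |f (lam i)|)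
    (hk : 1 ≤ k) (hkn : k ≤ n) (hs : 1 ≤ s)
    (hγ : 2 ≤ k → gammaMin lam k ≠ 0)
    (hδ0 : 0 < δ) (hδ1 : δ < 1)
    {S : Type*} [MeasurableSpace S] (P : Measure S) [IsProbabilityMeasure P]
    (ω : S → Fin n → ℝ)
    (hω : HasLaw ω (Measure.pi fun _ : Fin n => gaussianReal 0 1) P) :
    ∃ G : Set S, MeasurableSet G ∧ ENNReal.ofReal (1 - δ) ≤ P G ∧
      ∀ x ∈ G, ∀ B : Matrix (Fin n) (Fin n) ℝ,
        IsSingleVectorKrylovAware A f k s r (ω x) B →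
        ENNReal.ofReal (frobNorm (cfc f A - B)) ≤
          ENNReal.ofReal (4 * √((k : ℝ) + s)) *
              polyApproxError f (2 * r + 1) (⨅ i, lam i) (⨆ i, lam i) +
            ENNReal.ofReal (√(frobNorm (tailDiag lam k f) ^ 2 +
              Chat δ * ((k : ℝ) ^ 4 / gammaMin lam k ^ (2 * (k - 1))) * minRatio lam f k s)) := by
  have hU1 : Uᵀ * U = 1 := (Matrix.mem_orthogonalGroup_iff' (Fin n) ℝ).1 hU
  have hne : Nonempty {p : Polynomial ℝ // p ∈ Polynomial.degreeLT ℝ s ∧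
      ∀ i : Fin n, (i : ℕ) < k → p.eval (lam i) ≠ 0} := by
    -- The constant 1 is admissible because s ≥ 1; over an empty index type the real infimum would
    -- be the default value 0.
    refine ⟨⟨1, ?_, fun i _ => by simp⟩⟩
    rw [Polynomial.mem_degreeLT, Polynomial.degree_one]
    exact_mod_cast hs
  have hex : ∀ m : ℕ, ∃ p : {p : Polynomial ℝ // p ∈ Polynomial.degreeLT ℝ s ∧
      ∀ i : Fin n, (i : ℕ) < k → p.eval (lam i) ≠ 0},
      frobNorm (tailDiag lam k fun x => p.1.eval x) ^ 2 *
        (⨆ i : {i : Fin n // (i : ℕ) < k}, |f (lam i) / p.1.eval (lam i)| ^ 2) <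
          minRatio lam f k s + 1 / ((m : ℝ) + 1) := fun m =>
    exists_lt_of_ciInf_lt (lt_add_of_pos_right _ Nat.one_div_pos_of_nat)
  choose p hp using hex
  have hdeg : ∀ m, (p m).1.natDegree < s := by
    intro m
    have h1 := Polynomial.mem_degreeLT.1 (p m).2.1
    rcases eq_or_ne (p m).1 0 with h0 | h0
    · rw [h0, Polynomial.natDegree_zero]; omega
    · exact (Polynomial.natDegree_lt_iff_degree_lt h0).2 h1
  set H := ⋂ N, ⋃ m, ⋃ (_ : N ≤ m), goodStart U lam k δ (p m).1 with hH
  have hHm : MeasurableSet H := MeasurableSet.iInter fun N => MeasurableSet.iUnion fun m =>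
    MeasurableSet.iUnion fun _ => measurableSet_goodStart _ _ _ _ _
  have hHc : (Measure.pi fun _ : Fin n => gaussianReal 0 1) Hᶜ ≤ ENNReal.ofReal δ :=
    measure_compl_iInter_iUnion_le fun m =>
      measure_compl_goodStart_le hU1 lam hk hkn hδ0 hδ1 (p m).1
  have hHP : ENNReal.ofReal (1 - δ) ≤ P (ω ⁻¹' H) := by
    rw [← Measure.map_apply_of_aemeasurable hω.aemeasurable hHm, hω.map_eq,
      ENNReal.ofReal_sub _ hδ0.le, ENNReal.ofReal_one, tsub_le_iff_right,
      ← prob_add_prob_compl (μ := Measure.pi fun _ : Fin n => gaussianReal 0 1) hHm]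
    exact add_le_add le_rfl hHc
  -- ω is only almost everywhere measurable, so the preimage of H is replaced by a measurable subset
  -- of the same measure.
  obtain ⟨G, hGsub, hGm, hGae⟩ :=
    (hω.aemeasurable.nullMeasurableSet_preimage hHm).exists_measurable_subset_ae_eq
  refine ⟨G, hGm, hHP.trans_eq (measure_congr hGae).symm, fun x hx B hB => ?_⟩
  have hxH : ω x ∈ H := hGsub hx
  have hbound : ∀ N : ℕ, ENNReal.ofReal (frobNorm (cfc f A - B)) ≤
      ENNReal.ofReal (4 * √((k : ℝ) + s)) *
          polyApproxError f (2 * r + 1) (⨅ i, lam i) (⨆ i, lam i) +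
        ENNReal.ofReal (√(frobNorm (tailDiag lam k f) ^ 2 +
          Chat δ * ((k : ℝ) ^ 4 / gammaMin lam k ^ (2 * (k - 1))) *
            (minRatio lam f k s + 1 / ((N : ℝ) + 1)))) := by
    intro N
    -- The usable indices m depend on x, but they are unbounded, which is enough for the limit N →
    -- ∞.
    obtain ⟨m, hNm, hm⟩ : ∃ m, ∃ _ : N ≤ m, ω x ∈ goodStart U lam k δ (p m).1 := by
      simpa only [Set.mem_iUnion] using Set.mem_iInter.1 hxH N
    refine ofReal_frobNorm_sub_le_of_mem_goodStart hU1 hA hlam hk hkn hγ hδ0 hδ1 (hdeg m)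
      (p m).2.2 hm hB ((hp m).le.trans (add_le_add le_rfl (Nat.one_div_le_one_div hNm)))
  have hlim : Filter.Tendsto (fun N : ℕ => minRatio lam f k s + 1 / ((N : ℝ) + 1)) Filter.atTop
      (nhds (minRatio lam f k s)) := by
    simpa using (tendsto_one_div_add_atTop_nhds_zero_nat (𝕜 := ℝ)).const_add (minRatio lam f k s)
  exact ge_of_tendsto' ((ENNReal.tendsto_ofReal ((Real.continuous_sqrt.tendsto _).comp
    ((hlim.const_mul _).const_add _))).const_add _) hbound
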